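/- **Corollary 4.7 (metric admissible connections).** Let $(M,g)$ be a smooth $n$-dimensional pseudo-Riemannian spin manifold with a fixed spin structure, and let $S$ be its (real or complex) spinor bundle, associated with an irreducible Clifford module, with Clifford multiplication $\gamma$ satisfying $\gamma(X)\gamma(Y)+\gamma(Y)\gamma(X)=-2g(X,Y)$. Let $C$ be a charge conjugation on $S$: a nondegenerate spin-invariant bilinear form such that $C(\varphi,\psi)=\Delta_0\,C(\psi,\varphi)$ and $C(\varphi,\gamma(X)\psi)=\Delta_1\,C(\psi,\gamma(X)\varphi)$ with signs $\Delta_0,\Delta_1\in\{\pm1\}$. Denote by $\nabla$ the Levi-Civita connection of $g$ on $TM$ and its lift to $S$. In a local orthonormal frame write $\gamma_\mu=\gamma(e_\mu)$ and $\gamma_{\mu\nu}=\tfrac12(\gamma_\mu\gamma_\nu-\gamma_\nu\gamma_\mu)$, and raise indices with $g$. For a connection $D$ on $S$ put $\mathcal A=D-\nabla\in\Omega^1(M)\otimes\Gamma\,\mathrm{End}(S)$, let $D^C$ be the connection on $S$ with $$X\big(C(\varphi,\psi)\big)=C(D_X\varphi,\psi)+C(\varphi,D^C_X\psi),$$ and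 put $(\hat D_Z\gamma)(X)\xi=D_Z(\gamma(X)\xi)-\gamma(\nabla_ZX)\xi-\gamma(X)D^C_Z\xi$. The connection $D$ is *admissible* if $\hat D\gamma$ is skew-symmetric, i.e. $(\hat D_Z\gamma)(X)=-(\hat D_X\gamma)(Z)$ for all vector fields $X,Z$. Its torsion is $\mathcal T(X,Y)=(\hat D_X\gamma)(Y)-(\hat D_Y\gamma)(X)$. Let $D$ be a *metric connection* on $S$, i.e. the lift to $S$ of a smooth connection $\nabla^D$ on $TM$ with $\nabla^Dg=0$. Put $$A(X,Y,Z)=g(\nabla^D_XY-\nabla_XY,\,Z),\qquad T(X,Y,Z)=g\big(T^{\nabla^D}(X,Y),Z\big),$$ where $T^{\nabla^D}$ is the torsion of $\nabla^D$. Then $\mathcal A_\mu=\tfrac14A_{\mu\nu\kappa}\gamma^{\nu\kappa}$ and $\mathcal T(X,Y)=\gamma\big(T^{\nabla^D}(X,Y)\big)$. Moreover: 1. $D$ is admissible if and only if $\mathcal A_X$ is of the form $X\rfloor F^{(3)}$, i.e. there is a smooth $3$-form $F$ on $M$ with $\mathcal A_\mu=F_{\mu\nu\kappa}\gamma^{\nu\kappa}$.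 2. $D$ is admissible if and only if its torsion $T$ is totally skew-symmetric. 3. If $D$ is admissible, then $T_{\mu\nu\kappa}=A_{\mu\nu\kappa}-A_{\nu\mu\kappa}=2A_{\mu\nu\kappa}$. -/

import Mathlib

open scoped Manifold ContDiff Bundle Topology

set_option linter.unusedSectionVars false

noncomputable section

namespace SpinGeometry

/-! ### Pseudo-Riemannian metrics and affine connections -/

/-- A smooth pseudo-Riemannian metric on an `n`-manifold: a smooth field of symmetric
nondegenerate bilinear forms on the tangent spaces. -/
structure PseudoRiemannianMetric (n : ℕ) (M : Type*) [TopologicalSpace M]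
    [ChartedSpace (EuclideanSpace ℝ (Fin n)) M] [IsManifold (𝓡 n) ∞ M] where
  inner (x : M) : TangentSpace (𝓡 n) x →L[ℝ] TangentSpace (𝓡 n) x →L[ℝ] ℝ
  symm (x : M) (u v : TangentSpace (𝓡 n) x) : inner x u v = inner x v u
  nondegenerate (x : M) (u : TangentSpace (𝓡 n) x) (hu : ∀ v, inner x u v = 0) : u = 0
  contMDiff : ContMDiff (𝓡 n)
    ((𝓡 n).prod 𝓘(ℝ, EuclideanSpace ℝ (Fin n) →L[ℝ] EuclideanSpace ℝ (Fin n) →L[ℝ] ℝ)) ∞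
    (fun x ↦ Bundle.TotalSpace.mk'
      (EuclideanSpace ℝ (Fin n) →L[ℝ] EuclideanSpace ℝ (Fin n) →L[ℝ] ℝ) x (inner x))

section Tangent

variable {n : ℕ} {M : Type*} [TopologicalSpace M]
  [ChartedSpace (EuclideanSpace ℝ (Fin n)) M] [IsManifold (𝓡 n) ∞ M]

variable (n M) in
/-- Affine connections on `M`, that is, covariant derivatives on the tangent bundle.
The value `∇ Y x v` is the derivative of the field `Y` at `x` in the direction `v`. -/
abbrev AffineConnection : Type _ :=
  CovariantDerivative (𝓡 n) (EuclideanSpace ℝ (Fin n))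
    (TangentSpace (𝓡 n) : M → Type _)

/-- Differentiability at a point of a (not necessarily continuous) vector field. -/
abbrev FieldDiffAt (Y : Π x : M, TangentSpace (𝓡 n) x) (x : M) : Prop :=
  MDifferentiableAt (𝓡 n) ((𝓡 n).prod 𝓘(ℝ, EuclideanSpace ℝ (Fin n)))
    (fun y ↦ Bundle.TotalSpace.mk' (EuclideanSpace ℝ (Fin n)) y (Y y)) x

/-- Smoothness of a vector field on a set. -/
abbrev FieldSmoothOn (Y : Π x : M, TangentSpace (𝓡 n) x) (s : Set M) : Prop :=
  ContMDiffOn (𝓡 n) ((𝓡 n).prod 𝓘(ℝ, EuclideanSpace ℝ (Fin n))) ∞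
    (fun y ↦ Bundle.TotalSpace.mk' (EuclideanSpace ℝ (Fin n)) y (Y y)) s

/-- Compatibility with the metric: `v (g(Y, Z)) = g(∇_v Y, Z) + g(Y, ∇_v Z)`. -/
def IsMetricAffine (g : PseudoRiemannianMetric n M) (cov : AffineConnection n M) : Prop :=
  ∀ (x : M) (Y Z : Π y : M, TangentSpace (𝓡 n) y), FieldDiffAt Y x → FieldDiffAt Z x →
    ∀ v : TangentSpace (𝓡 n) x,
      mvfderiv (𝓡 n) (fun y ↦ g.inner y (Y y) (Z y)) x v =
        g.inner x (cov Y x v) (Z x) + g.inner x (Y x) (cov Z x v)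

/-- The Levi-Civita connection: metric and torsion free. -/
def IsLeviCivita (g : PseudoRiemannianMetric n M) (cov : AffineConnection n M) : Prop :=
  IsMetricAffine g cov ∧ cov.torsion = 0

/-- The difference tensor of two affine connections with its last index lowered,
`A(u, v, w) = g(∇'_u v - ∇_u v, w)`. -/
def differenceTensor (g : PseudoRiemannianMetric n M) (cov' cov : AffineConnection n M) (x : M)
    (u v w : TangentSpace (𝓡 n) x) : ℝ :=
  g.inner x (cov'.difference cov x v u) w

/-- The torsion tensor of an affine connection with its last index lowered,
`T(u, v, w) = g(T(u, v), w)`. -/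
def loweredTorsion (g : PseudoRiemannianMetric n M) (cov : AffineConnection n M) (x : M)
    (u v w : TangentSpace (𝓡 n) x) : ℝ :=
  g.inner x (cov.torsion x u v) w

/-- A field of trilinear forms is totally skew-symmetric if it changes sign under the
transpositions of neighbouring arguments (these generate all permutations). -/
def IsTotallySkew (T : ∀ x : M, TangentSpace (𝓡 n) x → TangentSpace (𝓡 n) x →
    TangentSpace (𝓡 n) x → ℝ) : Prop :=
  ∀ (x : M) (u v w : TangentSpace (𝓡 n) x), T x v u w = -T x u v w ∧ T x u w v = -T x u v w

variable (n M) in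
/-- Smooth differential 3-forms: fields of alternating trilinear forms whose values on
smooth vector fields are smooth functions. -/
structure ThreeForm where
  toFun (x : M) : TangentSpace (𝓡 n) x [⋀^Fin 3]→L[ℝ] ℝ
  smooth (X Y Z : Π x : M, TangentSpace (𝓡 n) x) :
    FieldSmoothOn X Set.univ → FieldSmoothOn Y Set.univ → FieldSmoothOn Z Set.univ →
      ContMDiff (𝓡 n) 𝓘(ℝ, ℝ) ∞ (fun x ↦ toFun x ![X x, Y x, Z x])

end Tangent

/-! ### Clifford algebra, spinor modules and charge conjugations -/

/-- The quadratic form `v ↦ -∑ ε_a v_a²` on `ℝⁿ`. In its Clifford algebra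
`v w + w v = -2 ∑ ε_a v_a w_a`. -/
def modelForm {n : ℕ} (ε : Fin n → ℤˣ) : QuadraticForm ℝ (Fin n → ℝ) :=
  QuadraticMap.weightedSumSquares ℝ (fun a ↦ -(((ε a : ℤˣ) : ℤ) : ℝ))

/-- The Clifford algebra of the standard metric `diag(ε)` on `ℝⁿ`, with `v² = -g(v, v)`. -/
abbrev Cl {n : ℕ} (ε : Fin n → ℤˣ) : Type := CliffordAlgebra (modelForm ε)

/-- A spinor module over `𝕂` (real or complex spinors): an irreducible `𝕂`-linear
representation of the Clifford algebra. -/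
structure SpinorModule {n : ℕ} (ε : Fin n → ℤˣ) (𝕂 : Type*) [RCLike 𝕂] (S : Type*)
    [NormedAddCommGroup S] [NormedSpace ℝ S] [NormedSpace 𝕂 S] [IsScalarTower ℝ 𝕂 S] where
  rep : Cl ε →ₐ[ℝ] Module.End 𝕂 S
  nontrivial : Nontrivial S
  irreducible (W : Submodule 𝕂 S) (hW : ∀ a, ∀ φ ∈ W, rep a φ ∈ W) : W = ⊥ ∨ W = ⊤

section Module

variable {n : ℕ} {ε : Fin n → ℤˣ} {𝕂 : Type*} [RCLike 𝕂] {S : Type*}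
  [NormedAddCommGroup S] [NormedSpace ℝ S] [NormedSpace 𝕂 S] [IsScalarTower ℝ 𝕂 S]

namespace SpinorModule

/-- Clifford multiplication by a vector of `ℝⁿ`. -/
def mulVec (ρ : SpinorModule ε 𝕂 S) (v : Fin n → ℝ) : Module.End 𝕂 S :=
  ρ.rep (CliffordAlgebra.ι (modelForm ε) v)

/-- The matrix `γ_a`, Clifford multiplication by the `a`-th standard basis vector. -/
def gamma (ρ : SpinorModule ε 𝕂 S) (a : Fin n) : Module.End 𝕂 S :=
  ρ.mulVec (Pi.single a 1)

/-- The endomorphism `∑ c_{ab} γ^{[a} γ^{b]}`; indices are raised with `diag(ε)`. -/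
def cliffordTwo (ρ : SpinorModule ε 𝕂 S) (c : Fin n → Fin n → ℝ) : Module.End 𝕂 S :=
  ∑ a, ∑ b, (((ε a * ε b : ℤˣ) : ℤ) * c a b : ℝ) •
    ((1 / 2 : ℝ) • (ρ.gamma a * ρ.gamma b - ρ.gamma b * ρ.gamma a))

end SpinorModule

/-- A charge conjugation: a nondegenerate spin-invariant `𝕂`-bilinear form such that
`C(φ, ψ)` and `C(φ, γ(v) ψ)` are symmetric or skew-symmetric in `φ, ψ`, with signs
`Δ₀` and `Δ₁`. -/
structure ChargeConjugation (ρ : SpinorModule ε 𝕂 S) where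
  form : LinearMap.BilinForm 𝕂 S
  nondegenerate : form.Nondegenerate
  spin_invariant (s : Cl ε) (hs : s ∈ spinGroup (modelForm ε)) (φ ψ : S) :
    form (ρ.rep s φ) (ρ.rep s ψ) = form φ ψ
  Δ₀ : ℤˣ
  Δ₁ : ℤˣ
  symm₀ (φ ψ : S) : form φ ψ = ((Δ₀ : ℤ) : 𝕂) * form ψ φ
  symm₁ (v : Fin n → ℝ) (φ ψ : S) :
    form φ (ρ.mulVec v ψ) = ((Δ₁ : ℤ) : 𝕂) * form ψ (ρ.mulVec v φ)

end Module

/-! ### Spin structures and spinor bundles -/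

section Spin

variable {n : ℕ} {M : Type*} [TopologicalSpace M]
  [ChartedSpace (EuclideanSpace ℝ (Fin n)) M] [IsManifold (𝓡 n) ∞ M]

/-- A spin structure on `(M, g)`, given by its cocycle: an open cover with smooth orthonormal
frames of signature `ε` over its members, together with smooth lifts of the changes of frame
to the spin group that satisfy the cocycle condition. -/
structure SpinStructure (g : PseudoRiemannianMetric n M) (ε : Fin n → ℤˣ) (ι : Type*) where
  baseSet : ι → Set M
  isOpen_baseSet (i : ι) : IsOpen (baseSet i)
  indexAt : M → ι
  mem_baseSet_at (x : M) : x ∈ baseSet (indexAt x)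
  frame : ι → Fin n → Π x : M, TangentSpace (𝓡 n) x
  contMDiffOn_frame (i : ι) (a : Fin n) : FieldSmoothOn (frame i a) (baseSet i)
  orthonormal (i : ι) (x : M) (hx : x ∈ baseSet i) (a b : Fin n) :
    g.inner x (frame i a x) (frame i b x) = if a = b then (((ε a : ℤˣ) : ℤ) : ℝ) else 0
  /-- The lift of the change from the `i`-th to the `j`-th frame. -/
  transition : ι → ι → M → Cl ε
  mem_spinGroup (i j : ι) (x : M) (hx : x ∈ baseSet i ∩ baseSet j) :
    transition i j x ∈ spinGroup (modelForm ε)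
  /-- Smoothness, in linear coordinates of the Clifford algebra. -/
  contMDiffOn_transition (i j : ι) (f : Cl ε →ₗ[ℝ] ℝ) :
    ContMDiffOn (𝓡 n) 𝓘(ℝ, ℝ) ∞ (fun x ↦ f (transition i j x)) (baseSet i ∩ baseSet j)
  /-- If a tangent vector has components `v` in the `i`-th frame and `w` in the `j`-th frame,
  then `s v s⁻¹ = w`, where `s` is the transition. -/
  lift (i j : ι) (x : M) (hx : x ∈ baseSet i ∩ baseSet j) (v w : Fin n → ℝ)
    (hvw : ∑ a, v a • frame i a x = ∑ a, w a • frame j a x) :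
    transition i j x * CliffordAlgebra.ι (modelForm ε) v =
      CliffordAlgebra.ι (modelForm ε) w * transition i j x
  cocycle (i j k : ι) (x : M) (hx : x ∈ baseSet i ∩ baseSet j ∩ baseSet k) :
    transition j k x * transition i j x = transition i k x

namespace SpinStructure

variable {g : PseudoRiemannianMetric n M} {ε : Fin n → ℤˣ} {ι : Type*}
  {𝕂 : Type*} [RCLike 𝕂] {S : Type*}
  [NormedAddCommGroup S] [NormedSpace ℝ S] [NormedSpace 𝕂 S] [IsScalarTower ℝ 𝕂 S]
  [FiniteDimensional ℝ S]

theorem transition_self (P : SpinStructure g ε ι) (i : ι) (x : M) (hx : x ∈ P.baseSet i) :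
    P.transition i i x = 1 := by
  have h1 := P.cocycle i i i x ⟨⟨hx, hx⟩, hx⟩
  have h2 := spinGroup.star_mul_self_of_mem (P.mem_spinGroup i i x ⟨hx, hx⟩)
  calc P.transition i i x
      = (star (P.transition i i x) * P.transition i i x) * P.transition i i x := by
        rw [h2, one_mul]
    _ = 1 := by rw [mul_assoc, h1, h2]

/-- The action of Clifford algebra elements on spinors as continuous real-linear maps. -/
def actionL (ρ : SpinorModule ε 𝕂 S) : Cl ε →ₗ[ℝ] (S →L[ℝ] S) where
  toFun s := LinearMap.toContinuousLinearMap ((ρ.rep s).restrictScalars ℝ)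
  map_add' s t := by ext φ; simp
  map_smul' c s := by ext φ; simp

@[simp] theorem actionL_apply (ρ : SpinorModule ε 𝕂 S) (s : Cl ε) (φ : S) :
    actionL ρ s φ = ρ.rep s φ := rfl

theorem contMDiffOn_actionL (P : SpinStructure g ε ι) (ρ : SpinorModule ε 𝕂 S) (i j : ι) :
    ContMDiffOn (𝓡 n) 𝓘(ℝ, S →L[ℝ] S) ∞ (fun x ↦ actionL ρ (P.transition i j x))
      (P.baseSet i ∩ P.baseSet j) := by
  let b := Module.finBasis ℝ (S →L[ℝ] S)
  have h : (fun x ↦ actionL ρ (P.transition i j x)) =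
      fun x ↦ ∑ k, ((b.coord k) ∘ₗ actionL ρ) (P.transition i j x) • b k := by
    funext x
    exact (b.sum_repr _).symm
  rw [h]
  refine contMDiffOn_finsetSum (fun k _ ↦ ?_)
  exact (P.contMDiffOn_transition i j _).smul contMDiffOn_const

/-- The spinor bundle of a spin structure: the vector bundle associated with a spinor module. -/
def spinorCore (P : SpinStructure g ε ι) (ρ : SpinorModule ε 𝕂 S) :
    VectorBundleCore ℝ M S ι where
  baseSet := P.baseSet
  isOpen_baseSet := P.isOpen_baseSet
  indexAt := P.indexAt
  mem_baseSet_at := P.mem_baseSet_at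
  coordChange i j x := actionL ρ (P.transition i j x)
  coordChange_self i x hx v := by simp [P.transition_self i x hx]
  continuousOn_coordChange i j := (P.contMDiffOn_actionL ρ i j).continuousOn
  coordChange_comp i j k x hx v := by
    simp [← P.cocycle i j k x hx]

/-- The fibre of the spinor bundle; as a vector space it is the spinor module, through the
preferred frame at the point. -/
abbrev Spinors (P : SpinStructure g ε ι) (ρ : SpinorModule ε 𝕂 S) : M → Type _ :=
  (P.spinorCore ρ).Fiber

instance (P : SpinStructure g ε ι) (ρ : SpinorModule ε 𝕂 S) :
    (P.spinorCore ρ).IsContMDiff (𝓡 n) ∞ :=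
  ⟨fun i j ↦ P.contMDiffOn_actionL ρ i j⟩

instance (P : SpinStructure g ε ι) (ρ : SpinorModule ε 𝕂 S) (x : M) :
    IsTopologicalAddGroup (P.Spinors ρ x) :=
  inferInstanceAs (IsTopologicalAddGroup S)

instance (P : SpinStructure g ε ι) (ρ : SpinorModule ε 𝕂 S) (x : M) :
    ContinuousSMul ℝ (P.Spinors ρ x) :=
  inferInstanceAs (ContinuousSMul ℝ S)

/-- An endomorphism of the spinor module, acting on the fibre through the preferred frame. -/
def actFiber (P : SpinStructure g ε ι) (ρ : SpinorModule ε 𝕂 S) (x : M)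
    (Φ : Module.End 𝕂 S) (ψ : P.Spinors ρ x) : P.Spinors ρ x :=
  Φ (ψ : S)

/-- The orthonormal frame used to identify the fibre at `x` with the spinor module. -/
def frameAt (P : SpinStructure g ε ι) (x : M) (a : Fin n) : TangentSpace (𝓡 n) x :=
  P.frame (P.indexAt x) a x

/-- Clifford multiplication `γ(v) ψ` of a spinor by a tangent vector. -/
def clifford (P : SpinStructure g ε ι) (ρ : SpinorModule ε 𝕂 S) (x : M)
    (v : TangentSpace (𝓡 n) x) (ψ : P.Spinors ρ x) : P.Spinors ρ x :=
  P.actFiber ρ x (ρ.mulVec (fun a ↦ (((ε a : ℤˣ) : ℤ) : ℝ) * g.inner x v (P.frameAt x a))) ψ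

/-- The Clifford action `β_{νκ} γ^{νκ} ψ` of a bilinear form `β` on the tangent space. -/
def cliffordForm (P : SpinStructure g ε ι) (ρ : SpinorModule ε 𝕂 S) (x : M)
    (β : TangentSpace (𝓡 n) x → TangentSpace (𝓡 n) x → ℝ) (ψ : P.Spinors ρ x) :
    P.Spinors ρ x :=
  P.actFiber ρ x (ρ.cliffordTwo (fun a b ↦ β (P.frameAt x a) (P.frameAt x b))) ψ

/-- The pairing `C(φ, ψ)` of two spinors at `x` given by a charge conjugation. -/
def pairing (P : SpinStructure g ε ι) (ρ : SpinorModule ε 𝕂 S) (C : ChargeConjugation ρ)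
    (x : M) (φ ψ : P.Spinors ρ x) : 𝕂 :=
  C.form (φ : S) (ψ : S)

/-- The representative of a section of the spinor bundle in the `i`-th frame. -/
def localRep (P : SpinStructure g ε ι) (ρ : SpinorModule ε 𝕂 S) (i : ι)
    (σ : Π x : M, P.Spinors ρ x) (x : M) : S :=
  (P.spinorCore ρ).coordChange (P.indexAt x) i x (σ x)

/-- Connections on the spinor bundle. -/
abbrev SpinorConnection (P : SpinStructure g ε ι) (ρ : SpinorModule ε 𝕂 S) : Type _ :=
  CovariantDerivative (𝓡 n) S (P.Spinors ρ)

/-- Differentiability at a point of a section of the spinor bundle. -/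
abbrev SpinorDiffAt (P : SpinStructure g ε ι) (ρ : SpinorModule ε 𝕂 S)
    (σ : Π x : M, P.Spinors ρ x) (x : M) : Prop :=
  MDifferentiableAt (𝓡 n) ((𝓡 n).prod 𝓘(ℝ, S)) (fun y ↦ Bundle.TotalSpace.mk' S y (σ y)) x

/-- The connection form `v ↦ (1/4) g(∇_v e_a, e_b) γ^{ab} ψ` at `x` of the spin lift of an
affine connection, in the preferred orthonormal frame `e` at `x`. -/
def connectionForm (P : SpinStructure g ε ι) (ρ : SpinorModule ε 𝕂 S)
    (cov : AffineConnection n M) (x : M) (ψ : S) : TangentSpace (𝓡 n) x →L[ℝ] S :=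
  haveI : FiniteDimensional ℝ (TangentSpace (𝓡 n) x) :=
    inferInstanceAs (FiniteDimensional ℝ (EuclideanSpace ℝ (Fin n)))
  haveI : T2Space (TangentSpace (𝓡 n) x) :=
    inferInstanceAs (T2Space (EuclideanSpace ℝ (Fin n)))
  LinearMap.toContinuousLinearMap
    { toFun := fun v ↦ (1 / 4 : ℝ) • ρ.cliffordTwo (fun a b ↦
        g.inner x (cov (P.frame (P.indexAt x) a) x v) (P.frameAt x b)) ψ
      map_add' := fun u v ↦ by
        simp [SpinorModule.cliffordTwo, mul_add, add_smul, Finset.sum_add_distrib]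
      map_smul' := fun c v ↦ by
        simp only [SpinorModule.cliffordTwo, map_smul, _root_.smul_apply,
          smul_eq_mul, mul_left_comm _ c, mul_smul, RingHom.id_apply, ← Finset.smul_sum,
          LinearMap.smul_apply, smul_comm _ c] }

theorem connectionForm_add (P : SpinStructure g ε ι) (ρ : SpinorModule ε 𝕂 S)
    (cov : AffineConnection n M) (x : M) (φ ψ : S) :
    P.connectionForm ρ cov x (φ + ψ) = P.connectionForm ρ cov x φ + P.connectionForm ρ cov x ψ := by
  ext v
  simp [connectionForm]

theorem connectionForm_smul (P : SpinStructure g ε ι) (ρ : SpinorModule ε 𝕂 S)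
    (cov : AffineConnection n M) (x : M) (c : ℝ) (φ : S) :
    P.connectionForm ρ cov x (c • φ) = c • P.connectionForm ρ cov x φ := by
  ext v
  simp [connectionForm, LinearMap.map_smul_of_tower, smul_comm _ c]

/-- Local representatives of differentiable spinor fields are differentiable. -/
theorem SpinorDiffAt.localRep {P : SpinStructure g ε ι} {ρ : SpinorModule ε 𝕂 S}
    {σ : Π x : M, P.Spinors ρ x} {x : M} (h : P.SpinorDiffAt ρ σ x) :
    MDifferentiableAt (𝓡 n) 𝓘(ℝ, S) (P.localRep ρ (P.indexAt x) σ) x :=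
  (mdifferentiableAt_section (𝓡 n) σ).1 h

/-- The connection on the spinor bundle induced by a metric affine connection (its spin lift):
in a frame `e` of the spin structure,
`∇_v σ = dσ(v) + (1/4) g(∇_v e_a, e_b) γ^{ab} σ`. -/
def spinLift (P : SpinStructure g ε ι) (ρ : SpinorModule ε 𝕂 S)
    (cov : AffineConnection n M) : P.SpinorConnection ρ where
  toFun σ x := (mvfderiv (𝓡 n) (P.localRep ρ (P.indexAt x) σ) x +
    P.connectionForm ρ cov x (σ x) : TangentSpace (𝓡 n) x →L[ℝ] S)
  isCovariantDerivativeOnUniv :=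
    { add := fun {σ σ'} x hσ hσ' _ ↦ by
        have h : P.localRep ρ (P.indexAt x) (σ + σ') =
            P.localRep ρ (P.indexAt x) σ + P.localRep ρ (P.indexAt x) σ' := by
          funext y
          exact map_add ((P.spinorCore ρ).coordChange (P.indexAt y) (P.indexAt x) y) (σ y : S) _
        have h1 := mvfderiv_add (SpinorDiffAt.localRep hσ) (SpinorDiffAt.localRep hσ')
        have h2 := P.connectionForm_add ρ cov x (σ x) (σ' x)
        rw [h]
        refine (congrArg₂ (· + ·) h1 h2).trans ?_
        exact add_add_add_comm _ _ _ _
      leibniz := fun {σ f} x hσ hf _ ↦ by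
        have h : P.localRep ρ (P.indexAt x) (f • σ) = f • P.localRep ρ (P.indexAt x) σ := by
          funext y
          exact map_smul ((P.spinorCore ρ).coordChange (P.indexAt y) (P.indexAt x) y) (f y)
            (σ y : S)
        have h1 := mvfderiv_smul hf (SpinorDiffAt.localRep hσ)
        have h2 := P.connectionForm_smul ρ cov x (f x) (σ x)
        have h3 : P.localRep ρ (P.indexAt x) σ x = (σ x : S) :=
          (P.spinorCore ρ).coordChange_self _ x (P.mem_baseSet_at x) _
        rw [h3] at h1
        rw [h]
        refine (congrArg₂ (· + ·) h1 h2).trans ?_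
        have key : ∀ (c : ℝ) (α β δ : TangentSpace (𝓡 n) x →L[ℝ] S),
            c • α + β + c • δ = c • (α + δ) + β := by
          intro c α β δ
          rw [add_right_comm, ← smul_add]
        exact key _ _ _ _ }

/-- `D` is the metric connection on the spinor bundle induced by the metric affine connection
`cov`. -/
def IsMetricConnection (P : SpinStructure g ε ι) (ρ : SpinorModule ε 𝕂 S)
    (D : P.SpinorConnection ρ) (cov : AffineConnection n M) : Prop :=
  IsMetricAffine g cov ∧ ∀ (σ : Π x : M, P.Spinors ρ x) (x : M), P.SpinorDiffAt ρ σ x →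
    D σ x = P.spinLift ρ cov σ x

/-- `DC` is the connection `D^C` associated with `D`: the charge conjugation is parallel with
respect to `D ⊗ 1 + 1 ⊗ D^C`, i.e. `v (C(φ, ψ)) = C(D_v φ, ψ) + C(φ, D^C_v ψ)`. -/
def IsChargeAssociated (P : SpinStructure g ε ι) (ρ : SpinorModule ε 𝕂 S)
    (C : ChargeConjugation ρ) (D DC : P.SpinorConnection ρ) : Prop :=
  ∀ (x : M) (φ ψ : Π x : M, P.Spinors ρ x), P.SpinorDiffAt ρ φ x → P.SpinorDiffAt ρ ψ x →
    ∀ v : TangentSpace (𝓡 n) x,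
      mvfderiv (𝓡 n) (fun y ↦ P.pairing ρ C y (φ y) (ψ y)) x v =
        P.pairing ρ C x (D φ x v) (ψ x) + P.pairing ρ C x (φ x) (DC ψ x v)

/-- `(D̂_Z γ)(X) ξ = D_Z (γ(X) ξ) - γ(∇_Z X) ξ - γ(X) D^C_Z ξ`. -/
def hatDGamma (P : SpinStructure g ε ι) (ρ : SpinorModule ε 𝕂 S) (cov : AffineConnection n M)
    (D DC : P.SpinorConnection ρ) (Z X : Π x : M, TangentSpace (𝓡 n) x)
    (ξ : Π x : M, P.Spinors ρ x) (x : M) : P.Spinors ρ x :=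
  D (fun y ↦ P.clifford ρ y (X y) (ξ y)) x (Z x) - P.clifford ρ x (cov X x (Z x)) (ξ x) -
    P.clifford ρ x (X x) (DC ξ x (Z x))

/-- The torsion `𝒯(Z, X) = (D̂_Z γ)(X) - (D̂_X γ)(Z)` of a connection on the spinor bundle,
applied to a spinor field. -/
def spinorTorsion (P : SpinStructure g ε ι) (ρ : SpinorModule ε 𝕂 S)
    (cov : AffineConnection n M) (D DC : P.SpinorConnection ρ)
    (Z X : Π x : M, TangentSpace (𝓡 n) x) (ξ : Π x : M, P.Spinors ρ x) (x : M) :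
    P.Spinors ρ x :=
  P.hatDGamma ρ cov D DC Z X ξ x - P.hatDGamma ρ cov D DC X Z ξ x

/-- A connection `D` on the spinor bundle is admissible if `D̂ γ` is skew-symmetric;
`cov` is the Levi-Civita connection. -/
def IsAdmissible (P : SpinStructure g ε ι) (ρ : SpinorModule ε 𝕂 S) (C : ChargeConjugation ρ)
    (cov : AffineConnection n M) (D : P.SpinorConnection ρ) : Prop :=
  ∃ DC : P.SpinorConnection ρ, P.IsChargeAssociated ρ C D DC ∧
    ∀ (x : M) (Z X : Π x : M, TangentSpace (𝓡 n) x) (ξ : Π x : M, P.Spinors ρ x),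
      FieldDiffAt Z x → FieldDiffAt X x → P.SpinorDiffAt ρ ξ x →
        P.hatDGamma ρ cov D DC Z X ξ x = -P.hatDGamma ρ cov D DC X Z ξ x

/-- The endomorphism-valued one-form `𝒜 = D - ∇`, where `∇` is the spin lift of `cov`. -/
def potential (P : SpinStructure g ε ι) (ρ : SpinorModule ε 𝕂 S) (cov : AffineConnection n M)
    (D : P.SpinorConnection ρ) (x : M) (v : TangentSpace (𝓡 n) x) (ψ : P.Spinors ρ x) :
    P.Spinors ρ x :=
  D.difference (P.spinLift ρ cov) x ψ v

end SpinStructure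

end Spin

end SpinGeometry

end

/-! The computation behind everything is the commutator of a bivector with a vector: for skew `c`,
`[c_{ab} γ^{ab}, γ(v)]` is Clifford multiplication by four times the contraction of `v` with `c`
(`cliffordTwo_commutator`). The 4 cancels the 1/4 in the spin lift, so `D_Z(γ(X)ξ) = γ(∇^D_Z X)ξ +
γ(X) D_Z ξ` (`spinLift_clifford`). Bivectors are also skew for `C`, since `γ_a γ_b` passes to the
other argument as `γ_b γ_a` with all signs squared (`form_cliffordTwo`). Hence `C` is parallel for
`D`, and nondegeneracy forces `D^C = D` on differentiable spinor fields.

Inserting both facts in the definition of `D̂γ` leaves `(D̂_Z γ)(X) = γ(∇^D_Z X - ∇_Z X)`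
(`hatDGamma_eq`). Antisymmetrising gives the spinor torsion. As `γ` is injective on vectors, `D` is
admissible exactly when `A` is skew in its first two arguments. Metricity already makes `A` skew in
its last two, so admissible means that `A` is alternating.

What remains is tensor algebra. Since the Levi-Civita connection is torsion free, `T(u,v,w) =
A(u,v,w) - A(v,u,w)`, and a Koszul-type identity recovers `A` from `T`. The potential is the
Clifford action of `A/4`. A skew form is determined by that action, again by the commutator, so the
only possible 3-form is `F = A/4`. -/

noncomputable section

namespace SpinGeometry

/-! ### Vectors and bivectors acting on the spinor module. -/

namespace SpinorModule

variable {n : ℕ} {ε : Fin n → ℤˣ} {𝕂 : Type*} [RCLike 𝕂] {S : Type*}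
  [NormedAddCommGroup S] [NormedSpace ℝ S] [NormedSpace 𝕂 S] [IsScalarTower ℝ 𝕂 S]

theorem sign_mul_sign (u : ℤˣ) : ((u : ℤ) : ℝ) * ((u : ℤ) : ℝ) = 1 := by
  rcases Int.units_eq_one_or u with h | h <;> simp [h]

theorem mulVec_smul (ρ : SpinorModule ε 𝕂 S) (c : ℝ) (v : Fin n → ℝ) :
    ρ.mulVec (c • v) = c • ρ.mulVec v := by
  simp [mulVec]

theorem mulVec_neg (ρ : SpinorModule ε 𝕂 S) (v : Fin n → ℝ) :
    ρ.mulVec (-v) = -ρ.mulVec v := by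
  simp [mulVec]

theorem mulVec_sub (ρ : SpinorModule ε 𝕂 S) (v w : Fin n → ℝ) :
    ρ.mulVec (v - w) = ρ.mulVec v - ρ.mulVec w := by
  simp [mulVec]

theorem mulVec_eq_sum (ρ : SpinorModule ε 𝕂 S) (v : Fin n → ℝ) :
    ρ.mulVec v = ∑ a, v a • ρ.gamma a := by
  conv_lhs => rw [pi_eq_sum_univ' v]
  simp only [mulVec, gamma, map_sum, map_smul]

/-- The Clifford relation in coordinates. -/
theorem mulVec_mul_mulVec_add_swap (ρ : SpinorModule ε 𝕂 S) (v w : Fin n → ℝ) :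
    ρ.mulVec v * ρ.mulVec w + ρ.mulVec w * ρ.mulVec v =
      (-2 * ∑ a, ((ε a : ℤ) : ℝ) * (v a * w a)) • (1 : Module.End 𝕂 S) := by
  simp only [mulVec, ← map_mul, ← map_add, CliffordAlgebra.ι_mul_ι_add_swap]
  rw [AlgHom.commutes, Algebra.algebraMap_eq_smul_one]
  congr 1
  simp only [QuadraticMap.polar, modelForm, QuadraticMap.weightedSumSquares_apply, Finset.mul_sum,
    ← Finset.sum_sub_distrib, Pi.add_apply, smul_eq_mul]
  refine Finset.sum_congr rfl fun a _ ↦ ?_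
  ring

theorem gamma_mul_gamma_add_swap (ρ : SpinorModule ε 𝕂 S) (a b : Fin n) :
    ρ.gamma a * ρ.gamma b + ρ.gamma b * ρ.gamma a =
      (if a = b then -2 * ((ε a : ℤ) : ℝ) else 0) • (1 : Module.End 𝕂 S) := by
  rw [gamma, gamma, mulVec_mul_mulVec_add_swap]
  congr 1
  split_ifs with h
  · subst h; simp [Pi.single_apply]
  · simp [Pi.single_apply, Ne.symm h]

/-- Clifford multiplication is injective on vectors. -/
theorem eq_zero_of_mulVec_eq_zero (ρ : SpinorModule ε 𝕂 S) {v : Fin n → ℝ}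
    (h : ρ.mulVec v = 0) : v = 0 := by
  have := ρ.nontrivial
  funext a
  have h1 := ρ.mulVec_mul_mulVec_add_swap v (Pi.single a 1)
  rw [h, zero_mul, mul_zero, add_zero] at h1
  obtain ⟨φ, hφ⟩ := exists_ne (0 : S)
  have h2 := congrArg (fun Φ : Module.End 𝕂 S ↦ Φ φ) h1
  simp [Pi.single_apply, hφ] at h2
  exact h2

theorem mulVec_injective (ρ : SpinorModule ε 𝕂 S) : Function.Injective ρ.mulVec := by
  intro v w h
  rw [← sub_eq_zero]
  apply ρ.eq_zero_of_mulVec_eq_zero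
  rw [mulVec_sub, h, sub_self]

/-- The adjoint action of a bivector on a vector. -/
theorem cliffordTwo_commutator (ρ : SpinorModule ε 𝕂 S) (c : Fin n → Fin n → ℝ)
    (hc : ∀ a b, c b a = -c a b) (v : Fin n → ℝ) :
    ρ.cliffordTwo c * ρ.mulVec v - ρ.mulVec v * ρ.cliffordTwo c =
      ρ.mulVec (fun b ↦ 4 * (((ε b : ℤ) : ℝ) * ∑ d, v d * c d b)) := by
  have key : ∀ a b d : Fin n,
      (ρ.gamma a * ρ.gamma b - ρ.gamma b * ρ.gamma a) * ρ.gamma d -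
        ρ.gamma d * (ρ.gamma a * ρ.gamma b - ρ.gamma b * ρ.gamma a) =
      (if a = d then 4 * ((ε a : ℤ) : ℝ) else 0) • ρ.gamma b -
        (if b = d then 4 * ((ε b : ℤ) : ℝ) else 0) • ρ.gamma a := by
    intro a b d
    have h1 := ρ.gamma_mul_gamma_add_swap a d
    have h2 := ρ.gamma_mul_gamma_add_swap b d
    -- The commutator is rewritten through anticommutators only, because these are scalars by the
    -- Clifford relation.
    have e : (ρ.gamma a * ρ.gamma b - ρ.gamma b * ρ.gamma a) * ρ.gamma d -
        ρ.gamma d * (ρ.gamma a * ρ.gamma b - ρ.gamma b * ρ.gamma a) =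
        ρ.gamma a * (ρ.gamma b * ρ.gamma d + ρ.gamma d * ρ.gamma b) +
        (ρ.gamma b * ρ.gamma d + ρ.gamma d * ρ.gamma b) * ρ.gamma a -
        (ρ.gamma a * ρ.gamma d + ρ.gamma d * ρ.gamma a) * ρ.gamma b -
        ρ.gamma b * (ρ.gamma a * ρ.gamma d + ρ.gamma d * ρ.gamma a) := by
      noncomm_ring
    rw [e, h1, h2]
    have e4 : ∀ (p : Prop) [Decidable p] (r : ℝ), (if p then 4 * r else 0) =
        -(if p then -2 * r else 0) - (if p then -2 * r else 0) := by
      intro p _ r; split_ifs <;> ring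
    rw [e4, e4]
    simp only [mul_smul_comm, smul_mul_assoc, mul_one, one_mul]
    module
  have hd : ∀ d, ρ.cliffordTwo c * ρ.gamma d - ρ.gamma d * ρ.cliffordTwo c =
      ∑ b, (4 * (((ε b : ℤ) : ℝ) * c d b)) • ρ.gamma b := by
    intro d
    have e1 : ρ.cliffordTwo c * ρ.gamma d - ρ.gamma d * ρ.cliffordTwo c =
        ∑ a, ∑ b, (((ε a * ε b : ℤˣ) : ℤ) * c a b : ℝ) • (1 / 2 : ℝ) •
          ((if a = d then 4 * ((ε a : ℤ) : ℝ) else 0) • ρ.gamma b -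
            (if b = d then 4 * ((ε b : ℤ) : ℝ) else 0) • ρ.gamma a) := by
      simp only [cliffordTwo, Finset.sum_mul, Finset.mul_sum, ← Finset.sum_sub_distrib,
        smul_mul_assoc, mul_smul_comm, ← smul_sub, key]
    rw [e1]
    simp only [smul_sub, Finset.sum_sub_distrib]
    -- After exchanging `a` and `b` in the second double sum, both collapse to the row `a = d`. By
    -- skewness of `c` they contribute equally, each with coefficient 2; the sign `ε d` appears
    -- squared.
    rw [Finset.sum_comm (f := fun a b ↦ (((ε a * ε b : ℤˣ) : ℤ) * c a b : ℝ) • (1 / 2 : ℝ) •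
          ((if b = d then 4 * ((ε b : ℤ) : ℝ) else 0) • ρ.gamma a)), ← Finset.sum_sub_distrib,
      Finset.sum_eq_single d]
    · rw [← Finset.sum_sub_distrib]
      refine Finset.sum_congr rfl fun b _ ↦ ?_
      rw [hc d b]
      simp only [if_true, smul_smul, ← sub_smul]
      congr 1
      push_cast
      linear_combination (4 * ((ε b : ℤ) : ℝ) * c d b) * sign_mul_sign (ε d)
    · intro a _ ha
      simp [ha]
    · simp
  calc ρ.cliffordTwo c * ρ.mulVec v - ρ.mulVec v * ρ.cliffordTwo c
      = ∑ d, v d • (ρ.cliffordTwo c * ρ.gamma d - ρ.gamma d * ρ.cliffordTwo c) := by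
        rw [mulVec_eq_sum]
        simp only [Finset.sum_mul, Finset.mul_sum, ← Finset.sum_sub_distrib,
          smul_mul_assoc, mul_smul_comm, ← smul_sub]
    _ = _ := by
        rw [mulVec_eq_sum]
        simp only [hd, Finset.smul_sum, smul_smul, Finset.mul_sum]
        rw [Finset.sum_comm]
        refine Finset.sum_congr rfl fun b _ ↦ ?_
        rw [← Finset.sum_smul]
        congr 1
        refine Finset.sum_congr rfl fun d _ ↦ ?_
        ring

theorem cliffordTwo_smul_sub (ρ : SpinorModule ε 𝕂 S) (r : ℝ) (c c' : Fin n → Fin n → ℝ) :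
    ρ.cliffordTwo (fun a b ↦ r * (c a b - c' a b)) =
      r • (ρ.cliffordTwo c - ρ.cliffordTwo c') := by
  simp only [cliffordTwo, ← Finset.sum_sub_distrib, Finset.smul_sum]
  refine Finset.sum_congr rfl fun a _ ↦ Finset.sum_congr rfl fun b _ ↦ ?_
  module

/-- The Leibniz rule of the spin lift at one point, freed of the manifold. There `u` holds the
components of `∇X`, `v` those of `X`, `c` the connection coefficients, `φ` the spinor and `ψ` its
derivative, with `r = 1/4`. -/
theorem mulVec_sub_commutator_apply (ρ : SpinorModule ε 𝕂 S) (c : Fin n → Fin n → ℝ)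
    (hc : ∀ a b, c b a = -c a b) (u v : Fin n → ℝ) (r : ℝ) (φ ψ : S) :
    ρ.mulVec (u - r • fun b ↦ 4 * (((ε b : ℤ) : ℝ) * ∑ d, v d * c d b)) φ + ρ.mulVec v ψ +
        r • ρ.cliffordTwo c (ρ.mulVec v φ) =
      ρ.mulVec u φ + ρ.mulVec v (ψ + r • ρ.cliffordTwo c φ) := by
  rw [mulVec_sub, mulVec_smul, ← ρ.cliffordTwo_commutator c hc]
  simp only [LinearMap.sub_apply, LinearMap.smul_apply, Module.End.mul_apply, map_add,
    LinearMap.map_smul_of_tower]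
  module

/-- A bivector is determined by its action on spinors. -/
theorem eq_of_cliffordTwo_eq (ρ : SpinorModule ε 𝕂 S) {c c' : Fin n → Fin n → ℝ}
    (hc : ∀ a b, c b a = -c a b) (hc' : ∀ a b, c' b a = -c' a b)
    (h : ρ.cliffordTwo c = ρ.cliffordTwo c') : c = c' := by
  funext a b
  -- The commutator with `γ_a` reads off the row `c a` up to nonzero factors, so faithfulness of the
  -- Clifford representation is not needed.
  have h1 := ρ.cliffordTwo_commutator c hc (Pi.single a 1)
  rw [h, ρ.cliffordTwo_commutator c' hc'] at h1
  have h2 := congrFun (ρ.mulVec_injective h1) b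
  have h3 : ((ε b : ℤ) : ℝ) ≠ 0 := by simp
  simpa [Pi.single_apply, h3, eq_comm] using h2

end SpinorModule

/-! ### Behaviour of bivectors under the charge conjugation. -/

namespace ChargeConjugation

variable {n : ℕ} {ε : Fin n → ℤˣ} {𝕂 : Type*} [RCLike 𝕂] {S : Type*}
  [NormedAddCommGroup S] [NormedSpace ℝ S] [NormedSpace 𝕂 S] [IsScalarTower ℝ 𝕂 S]
  {ρ : SpinorModule ε 𝕂 S}

theorem sign_mul_sign (u : ℤˣ) : ((u : ℤ) : 𝕂) * ((u : ℤ) : 𝕂) = 1 := by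
  rcases Int.units_eq_one_or u with h | h <;> simp [h]

/-- Moving one `γ` across `C` costs the sign `Δ₀ Δ₁`; two moves cost its square and reverse the
order. -/
theorem form_gamma_mul_gamma (C : ChargeConjugation ρ) (a b : Fin n) (φ ψ : S) :
    C.form φ ((ρ.gamma a * ρ.gamma b) ψ) = C.form ((ρ.gamma b * ρ.gamma a) φ) ψ := by
  rw [Module.End.mul_apply, Module.End.mul_apply, SpinorModule.gamma, SpinorModule.gamma,
    C.symm₁, C.symm₀, C.symm₁, C.symm₀ ψ]
  linear_combination (C.form (ρ.mulVec (Pi.single b 1) (ρ.mulVec (Pi.single a 1) φ)) ψ) *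
    (((C.Δ₀ : ℤ) : 𝕂) * ((C.Δ₀ : ℤ) : 𝕂) * sign_mul_sign (𝕂 := 𝕂) C.Δ₁ + sign_mul_sign (𝕂 := 𝕂) C.Δ₀)

theorem form_real_smul_left (C : ChargeConjugation ρ) (r : ℝ) (φ ψ : S) :
    C.form (r • φ) ψ = r • C.form φ ψ := by
  rw [← algebraMap_smul 𝕂 r φ, map_smul, LinearMap.smul_apply, algebraMap_smul]

theorem form_real_smul_right (C : ChargeConjugation ρ) (r : ℝ) (φ ψ : S) :
    C.form φ (r • ψ) = r • C.form φ ψ := by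
  rw [← algebraMap_smul 𝕂 r ψ, map_smul, algebraMap_smul]

/-- Bivectors act by skew endomorphisms. -/
theorem form_cliffordTwo (C : ChargeConjugation ρ) (c : Fin n → Fin n → ℝ) (φ ψ : S) :
    C.form (ρ.cliffordTwo c φ) ψ + C.form φ (ρ.cliffordTwo c ψ) = 0 := by
  simp only [SpinorModule.cliffordTwo, LinearMap.sum_apply, LinearMap.smul_apply, map_sum,
    LinearMap.sub_apply, form_real_smul_left, form_real_smul_right, map_sub,
    form_gamma_mul_gamma, ← Finset.sum_add_distrib, ← smul_add]
  refine Finset.sum_eq_zero fun a _ ↦ Finset.sum_eq_zero fun b _ ↦ ?_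
  rw [sub_add_sub_cancel, sub_self, smul_zero, smul_zero]

/-- The pointwise reason why `C` is parallel: the connection form drops out of the product rule. -/
theorem form_add_cliffordTwo (C : ChargeConjugation ρ) (c : Fin n → Fin n → ℝ) (r : ℝ)
    (φ ψ φ' ψ' : S) :
    C.form (φ' + r • ρ.cliffordTwo c φ) ψ + C.form φ (ψ' + r • ρ.cliffordTwo c ψ) =
      C.form φ' ψ + C.form φ ψ' := by
  simp only [map_add, LinearMap.add_apply, form_real_smul_left, form_real_smul_right]
  rw [add_add_add_comm, ← smul_add, C.form_cliffordTwo, smul_zero, add_zero]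

theorem eq_of_form_eq (C : ChargeConjugation ρ) {ψ ψ' : S}
    (h : ∀ φ, C.form φ ψ = C.form φ ψ') : ψ = ψ' :=
  sub_eq_zero.1 <| C.nondegenerate.2 _ fun φ ↦ by rw [map_sub, h, sub_self]

end ChargeConjugation

end SpinGeometry
end

noncomputable section

namespace SpinGeometry

/-! ### Product rules for derivatives on manifolds. -/

section Calculus

variable {E : Type*} [NormedAddCommGroup E] [NormedSpace ℝ E]
  {H : Type*} [TopologicalSpace H] {I : ModelWithCorners ℝ E H}
  {M : Type*} [TopologicalSpace M] [ChartedSpace H M]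
  {F₁ F₂ F₃ : Type*} [NormedAddCommGroup F₁] [NormedSpace ℝ F₁]
  [NormedAddCommGroup F₂] [NormedSpace ℝ F₂] [NormedAddCommGroup F₃] [NormedSpace ℝ F₃]

theorem hasMFDerivAt_bilinear (B : F₁ →L[ℝ] F₂ →L[ℝ] F₃) {f : M → F₁} {h : M → F₂} {x : M}
    (hf : MDifferentiableAt I 𝓘(ℝ, F₁) f x) (hh : MDifferentiableAt I 𝓘(ℝ, F₂) h x) :
    HasMFDerivAt I 𝓘(ℝ, F₃) (fun y ↦ B (f y) (h y)) x
      ((B.isBoundedBilinearMap.deriv (f x, h x)).comp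
        ((mfderiv I 𝓘(ℝ, F₁) f x).prod (mfderiv I 𝓘(ℝ, F₂) h x))) := by
  have h1 := (B.isBoundedBilinearMap.hasFDerivAt (f x, h x)).hasMFDerivAt
  have h2 : HasMFDerivAt I 𝓘(ℝ, F₁ × F₂) (fun y ↦ (f y, h y)) x
      ((mfderiv I 𝓘(ℝ, F₁) f x).prod (mfderiv I 𝓘(ℝ, F₂) h x)) :=
    ⟨hf.hasMFDerivAt.1.prodMk hh.hasMFDerivAt.1, hf.hasMFDerivAt.2.prodMk hh.hasMFDerivAt.2⟩
  exact h1.comp x h2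

theorem mvfderiv_bilinear (B : F₁ →L[ℝ] F₂ →L[ℝ] F₃) {f : M → F₁} {h : M → F₂} {x : M}
    (hf : MDifferentiableAt I 𝓘(ℝ, F₁) f x) (hh : MDifferentiableAt I 𝓘(ℝ, F₂) h x)
    (v : TangentSpace I x) :
    mvfderiv I (fun y ↦ B (f y) (h y)) x v =
      B (mvfderiv I f x v) (h x) + B (f x) (mvfderiv I h x v) := by
  have h1 := congrArg (fun L ↦ L v) (hasMFDerivAt_bilinear B hf hh).mfderiv
  rw [add_comm]
  exact h1

theorem mvfderiv_pi {κ : Type*} [Fintype κ] {c : M → κ → ℝ} {x : M}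
    (hc : MDifferentiableAt I 𝓘(ℝ, κ → ℝ) c x) (v : TangentSpace I x) (k : κ) :
    mvfderiv I c x v k = mvfderiv I (fun y ↦ c y k) x v := by
  have h1 := ((ContinuousLinearMap.proj (R := ℝ) (φ := fun _ : κ ↦ ℝ) k).hasFDerivAt
    (x := c x)).hasMFDerivAt.comp x hc.hasMFDerivAt
  exact (congrArg (fun L ↦ L v) h1.mfderiv).symm

theorem mvfderiv_congr_of_eventuallyEq {f h : M → F₁} {x : M} (hfh : f =ᶠ[𝓝 x] h) :
    mvfderiv I f x = mvfderiv I h x := by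
  unfold mvfderiv
  rw [hfh.mfderiv_eq, hfh.eq_of_nhds]

end Calculus

/-! ### Difference tensor and torsion of affine connections. -/

section Tangent

variable {n : ℕ} {M : Type*} [TopologicalSpace M]
  [ChartedSpace (EuclideanSpace ℝ (Fin n)) M] [IsManifold (𝓡 n) ∞ M]

/-- Identities between tensors at a point are proved by extending the vectors to fields, to which
the axioms of a connection apply. -/
theorem exists_fieldDiffAt (x : M) (v : TangentSpace (𝓡 n) x) :
    ∃ X : Π y : M, TangentSpace (𝓡 n) y, FieldDiffAt X x ∧ X x = v :=
  ⟨FiberBundle.extend (EuclideanSpace ℝ (Fin n)) v,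
    FiberBundle.mdifferentiableAt_extend (𝓡 n) (EuclideanSpace ℝ (Fin n)) v, by simp⟩

theorem PseudoRiemannianMetric.mdifferentiableAt_inner (g : PseudoRiemannianMetric n M)
    {X Y : Π y : M, TangentSpace (𝓡 n) y} {x : M} (hX : FieldDiffAt X x) (hY : FieldDiffAt Y x) :
    MDifferentiableAt (𝓡 n) 𝓘(ℝ, ℝ) (fun y ↦ g.inner y (X y) (Y y)) x := by
  have h := MDifferentiableAt.clm_bundle_apply₂ (F₁ := EuclideanSpace ℝ (Fin n))
    (F₂ := EuclideanSpace ℝ (Fin n)) (F₃ := ℝ) (E₃ := fun _ : M ↦ ℝ)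
    ((g.contMDiff x).mdifferentiableAt (by simp)) hX hY
  rw [mdifferentiableAt_totalSpace] at h
  exact h.2

theorem PseudoRiemannianMetric.contMDiff_inner (g : PseudoRiemannianMetric n M)
    {X Y : Π y : M, TangentSpace (𝓡 n) y}
    (hX : FieldSmoothOn X Set.univ) (hY : FieldSmoothOn Y Set.univ) :
    ContMDiff (𝓡 n) 𝓘(ℝ, ℝ) ∞ (fun y ↦ g.inner y (X y) (Y y)) := by
  have h := ContMDiff.clm_bundle_apply₂ (F₁ := EuclideanSpace ℝ (Fin n))
    (F₂ := EuclideanSpace ℝ (Fin n)) (F₃ := ℝ) (E₃ := fun _ : M ↦ ℝ)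
    g.contMDiff (contMDiffOn_univ.1 hX) (contMDiffOn_univ.1 hY)
  intro x
  have h' := h x
  rw [Bundle.contMDiffAt_totalSpace] at h'
  exact h'.2

theorem PseudoRiemannianMetric.eq_of_inner (g : PseudoRiemannianMetric n M) {x : M}
    {u v : TangentSpace (𝓡 n) x} (h : ∀ w, g.inner x u w = g.inner x v w) : u = v := by
  rw [← sub_eq_zero]
  apply g.nondegenerate
  intro w
  rw [map_sub, _root_.sub_apply, h, sub_self]

theorem difference_apply (cov' cov : AffineConnection n M) {x : M}
    {X : Π y : M, TangentSpace (𝓡 n) y} (hX : FieldDiffAt X x) (v : TangentSpace (𝓡 n) x) :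
    cov'.difference cov x (X x) v = cov' X x v - cov X x v := by
  have h := IsCovariantDerivativeOn.difference_apply cov'.isCovariantDerivativeOnUniv
    cov.isCovariantDerivativeOnUniv (x := x) trivial hX
  exact congrArg (fun L ↦ L v) h

/-- The difference tensor of two metric connections is skew in its last two arguments. -/
theorem differenceTensor_swap_right {g : PseudoRiemannianMetric n M}
    {cov' cov : AffineConnection n M} (h' : IsMetricAffine g cov') (h : IsMetricAffine g cov)
    (x : M) (u v w : TangentSpace (𝓡 n) x) :
    differenceTensor g cov' cov x u w v = -differenceTensor g cov' cov x u v w := by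
  obtain ⟨Y, hY, rfl⟩ := exists_fieldDiffAt x v
  obtain ⟨Z, hZ, rfl⟩ := exists_fieldDiffAt x w
  have h1 := h' x Y Z hY hZ u
  have h2 := h x Y Z hY hZ u
  simp only [differenceTensor, difference_apply cov' cov hY, difference_apply cov' cov hZ, map_sub,
    _root_.sub_apply]
  rw [g.symm x (cov' Z x u), g.symm x (cov Z x u)]
  linarith

/-- Subtracting the vanishing torsion of `cov` removes the Lie bracket. -/
theorem torsion_eq_difference_sub (cov' : AffineConnection n M) {cov : AffineConnection n M}
    (h : cov.torsion = 0) (x : M) (u v : TangentSpace (𝓡 n) x) :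
    cov'.torsion x u v = cov'.difference cov x v u - cov'.difference cov x u v := by
  obtain ⟨X, hX, rfl⟩ := exists_fieldDiffAt x u
  obtain ⟨Y, hY, rfl⟩ := exists_fieldDiffAt x v
  have h0 := cov.torsion_apply hX hY
  rw [h] at h0
  rw [cov'.torsion_apply hX hY, difference_apply cov' cov hX, difference_apply cov' cov hY]
  have h1 : (0 : TangentSpace (𝓡 n) x) = _ := h0
  rw [eq_comm, sub_eq_zero] at h1
  rw [← h1]
  abel

theorem loweredTorsion_eq (g : PseudoRiemannianMetric n M) (cov' : AffineConnection n M)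
    {cov : AffineConnection n M} (h : cov.torsion = 0) (x : M) (u v w : TangentSpace (𝓡 n) x) :
    loweredTorsion g cov' x u v w =
      differenceTensor g cov' cov x u v w - differenceTensor g cov' cov x v u w := by
  simp only [loweredTorsion, differenceTensor, torsion_eq_difference_sub cov' h, map_sub,
    _root_.sub_apply]

/-- The torsion of a metric connection is totally skew-symmetric if and only if its difference
tensor with the Levi-Civita connection is skew-symmetric in its first two arguments. -/
theorem isTotallySkew_loweredTorsion_iff {g : PseudoRiemannianMetric n M}
    {cov' cov : AffineConnection n M} (h' : IsMetricAffine g cov') (h : IsLeviCivita g cov) :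
    IsTotallySkew (loweredTorsion g cov') ↔ ∀ (x : M) (u v w : TangentSpace (𝓡 n) x),
      differenceTensor g cov' cov x v u w = -differenceTensor g cov' cov x u v w := by
  have hs := differenceTensor_swap_right h' h.1
  have hT := loweredTorsion_eq g cov' h.2
  constructor
  -- Skewness of `A` in its last two arguments gives `2A(u,v,w) = T(u,v,w) - T(v,w,u) + T(w,u,v)`.
  -- For totally skew `T` the right side is `T(u,v,w)`, so `A = T/2`. Skewness of `T` in its first
  -- two arguments is automatic, hence only the other half of `hk` is used.
  · intro hk x u v w
    have h1 := (hk x u v w).2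
    have h2 := (hk x u w v).2
    have h3 := (hk x v u w).2
    have h4 := (hk x v w u).2
    have h5 := (hk x w u v).2
    simp only [hT] at h1 h2 h3 h4 h5
    linarith [hs x u v w, hs x v u w, hs x w u v]
  · intro hk x u v w
    simp only [hT]
    constructor
    · ring
    · linarith [hs x u v w, hs x v u w, hs x w u v, hk x u v w, hk x u w v]

end Tangent

end SpinGeometry
end

noncomputable section

namespace SpinGeometry

/-! ### Orthonormal frames, local representatives and the spin lift. -/

namespace SpinStructure

variable {n : ℕ} {M : Type*} [TopologicalSpace M]
  [ChartedSpace (EuclideanSpace ℝ (Fin n)) M] [IsManifold (𝓡 n) ∞ M]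
  {g : PseudoRiemannianMetric n M} {ε : Fin n → ℤˣ} {ι : Type*}

/-- The components of a tangent vector in the `i`-th frame. -/
def coords (P : SpinStructure g ε ι) (i : ι) (x : M) (v : TangentSpace (𝓡 n) x) : Fin n → ℝ :=
  fun a ↦ (((ε a : ℤˣ) : ℤ) : ℝ) * g.inner x v (P.frame i a x)

theorem coords_sub (P : SpinStructure g ε ι) (i : ι) (x : M) (u v : TangentSpace (𝓡 n) x) :
    P.coords i x (u - v) = P.coords i x u - P.coords i x v := by
  funext a
  simp [coords, mul_sub]

theorem coords_neg (P : SpinStructure g ε ι) (i : ι) (x : M) (u : TangentSpace (𝓡 n) x) :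
    P.coords i x (-u) = -P.coords i x u := by
  funext a
  simp [coords]

theorem linearIndependent_frame (P : SpinStructure g ε ι) {i : ι} {x : M}
    (hx : x ∈ P.baseSet i) : LinearIndependent ℝ (fun a ↦ P.frame i a x) := by
  rw [Fintype.linearIndependent_iff]
  intro c hc a
  have h := congrArg (fun v ↦ g.inner x v (P.frame i a x)) hc
  simpa [map_sum, P.orthonormal i x hx] using h

theorem span_frame (P : SpinStructure g ε ι) {i : ι} {x : M} (hx : x ∈ P.baseSet i) :
    Submodule.span ℝ (Set.range fun a ↦ P.frame i a x) = ⊤ := by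
  have : FiniteDimensional ℝ (TangentSpace (𝓡 n) x) :=
    inferInstanceAs (FiniteDimensional ℝ (EuclideanSpace ℝ (Fin n)))
  refine (P.linearIndependent_frame hx).span_eq_top_of_card_eq_finrank' ?_
  have h : Module.finrank ℝ (TangentSpace (𝓡 n) x) = n := finrank_euclideanSpace_fin (𝕜 := ℝ)
  rw [h, Fintype.card_fin]

theorem eq_of_inner_frame (P : SpinStructure g ε ι) {i : ι} {x : M} (hx : x ∈ P.baseSet i)
    {u v : TangentSpace (𝓡 n) x}
    (h : ∀ a, g.inner x u (P.frame i a x) = g.inner x v (P.frame i a x)) : u = v := by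
  apply g.eq_of_inner
  intro w
  have hw : w ∈ Submodule.span ℝ (Set.range fun a ↦ P.frame i a x) := by
    rw [P.span_frame hx]; trivial
  induction hw using Submodule.span_induction with
  | mem w hw => obtain ⟨a, rfl⟩ := hw; exact h a
  | zero => simp
  | add w w' _ _ h1 h2 => rw [map_add, map_add, h1, h2]
  | smul c w _ h1 => rw [map_smul, map_smul, h1]

theorem coords_injective (P : SpinStructure g ε ι) {i : ι} {x : M} (hx : x ∈ P.baseSet i) :
    Function.Injective (P.coords i x) := by
  intro u v h
  apply P.eq_of_inner_frame hx
  intro a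
  have h3 : ((ε a : ℤ) : ℝ) ≠ 0 := by simp
  exact mul_left_cancel₀ h3 (congrFun h a)

theorem sum_coords_smul_frame (P : SpinStructure g ε ι) {i : ι} {x : M} (hx : x ∈ P.baseSet i)
    (v : TangentSpace (𝓡 n) x) : ∑ a, P.coords i x v a • P.frame i a x = v := by
  apply P.eq_of_inner_frame hx
  intro b
  simp only [map_sum, _root_.sum_apply, map_smul, _root_.smul_apply, P.orthonormal i x hx,
    coords, smul_eq_mul, mul_ite, mul_zero, Finset.sum_ite_eq', Finset.mem_univ, if_true]
  linear_combination g.inner x v (P.frame i b x) * SpinorModule.sign_mul_sign (ε b)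

theorem fieldDiffAt_frame (P : SpinStructure g ε ι) {i : ι} {x : M} (hx : x ∈ P.baseSet i)
    (a : Fin n) : FieldDiffAt (P.frame i a) x :=
  ((P.contMDiffOn_frame i a).contMDiffAt ((P.isOpen_baseSet i).mem_nhds hx)).mdifferentiableAt
    (by simp)

/-- Covariant differentiation of the components of a field. -/
theorem mvfderiv_coords (P : SpinStructure g ε ι) {cov : AffineConnection n M}
    (hcov : IsMetricAffine g cov) {i : ι} {x : M} (hx : x ∈ P.baseSet i)
    {X : Π y : M, TangentSpace (𝓡 n) y} (hX : FieldDiffAt X x) (v : TangentSpace (𝓡 n) x)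
    (a : Fin n) :
    MDifferentiableAt (𝓡 n) 𝓘(ℝ, ℝ) (fun y ↦ P.coords i y (X y) a) x ∧
    mvfderiv (𝓡 n) (fun y ↦ P.coords i y (X y) a) x v = P.coords i x (cov X x v) a +
      ((ε a : ℤ) : ℝ) * g.inner x (X x) (cov (P.frame i a) x v) := by
  have h1 := g.mdifferentiableAt_inner hX (P.fieldDiffAt_frame hx a)
  have h2 := hcov x X _ hX (P.fieldDiffAt_frame hx a) v
  have h3 : MDifferentiableAt (𝓡 n) 𝓘(ℝ, ℝ) (fun _ : M ↦ ((ε a : ℤ) : ℝ)) x :=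
    mdifferentiableAt_const
  refine ⟨h3.mul h1, ?_⟩
  have h4 := congrArg (fun L ↦ L v) (mvfderiv_fun_mul h3 h1)
  refine h4.trans ?_
  rw [mvfderiv_const]
  simp only [_root_.add_apply, _root_.smul_apply, smul_eq_mul, h2, coords, mul_add]
  simp

variable {𝕂 : Type*} [RCLike 𝕂] {S : Type*}
  [NormedAddCommGroup S] [NormedSpace ℝ S] [NormedSpace 𝕂 S] [IsScalarTower ℝ 𝕂 S]
  [FiniteDimensional ℝ S]

/-- Clifford multiplication as a continuous bilinear map. -/
def mulVecL (ρ : SpinorModule ε 𝕂 S) : (Fin n → ℝ) →L[ℝ] S →L[ℝ] S :=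
  LinearMap.toContinuousLinearMap (actionL ρ ∘ₗ CliffordAlgebra.ι (modelForm ε))

/-- A charge conjugation as a continuous real-bilinear map. -/
def formL {ρ : SpinorModule ε 𝕂 S} (C : ChargeConjugation ρ) : S →L[ℝ] S →L[ℝ] 𝕂 :=
  LinearMap.toContinuousLinearMap
    { toFun := fun φ ↦ LinearMap.toContinuousLinearMap ((C.form φ).restrictScalars ℝ)
      map_add' := fun φ ψ ↦ by ext; simp
      map_smul' := fun c φ ↦ by ext; simp }

theorem clifford_sub (P : SpinStructure g ε ι) (ρ : SpinorModule ε 𝕂 S) (x : M)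
    (u v : TangentSpace (𝓡 n) x) (ψ : P.Spinors ρ x) :
    P.clifford ρ x (u - v) ψ = P.clifford ρ x u ψ - P.clifford ρ x v ψ := by
  have h := ρ.mulVec_sub (P.coords (P.indexAt x) x u) (P.coords (P.indexAt x) x v)
  rw [← P.coords_sub] at h
  exact congrArg (fun Φ : Module.End 𝕂 S ↦ Φ (ψ : S)) h

theorem clifford_neg (P : SpinStructure g ε ι) (ρ : SpinorModule ε 𝕂 S) (x : M)
    (u : TangentSpace (𝓡 n) x) (ψ : P.Spinors ρ x) :
    P.clifford ρ x (-u) ψ = -P.clifford ρ x u ψ := by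
  have h := ρ.mulVec_neg (P.coords (P.indexAt x) x u)
  rw [← P.coords_neg] at h
  exact congrArg (fun Φ : Module.End 𝕂 S ↦ Φ (ψ : S)) h

theorem localRep_self (P : SpinStructure g ε ι) (ρ : SpinorModule ε 𝕂 S)
    (σ : Π x : M, P.Spinors ρ x) (x : M) : P.localRep ρ (P.indexAt x) σ x = σ x :=
  (P.spinorCore ρ).coordChange_self _ x (P.mem_baseSet_at x) _

/-- `clifford` uses the preferred frame at each point, which may jump from point to point. Since
transitions intertwine the components of a vector in two frames, one fixed frame can be used
instead, and there the product can be differentiated. -/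
theorem localRep_clifford (P : SpinStructure g ε ι) (ρ : SpinorModule ε 𝕂 S) {i : ι}
    (X : Π y : M, TangentSpace (𝓡 n) y) (σ : Π x : M, P.Spinors ρ x) {y : M}
    (hy : y ∈ P.baseSet i) :
    P.localRep ρ i (fun z ↦ P.clifford ρ z (X z) (σ z)) y =
      mulVecL ρ (P.coords i y (X y)) (P.localRep ρ i σ y) := by
  have hy' := P.mem_baseSet_at y
  have h := P.lift (P.indexAt y) i y ⟨hy', hy⟩ (P.coords (P.indexAt y) y (X y))
    (P.coords i y (X y)) (by rw [P.sum_coords_smul_frame hy', P.sum_coords_smul_frame hy])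
  have h' := congrArg ρ.rep h
  rw [map_mul, map_mul] at h'
  exact congrArg (fun Φ : Module.End 𝕂 S ↦ Φ (σ y : S)) h'

/-- Spin invariance of `C` makes the pairing independent of the frame, so it too can be
differentiated in a fixed one. -/
theorem pairing_eq_localRep (P : SpinStructure g ε ι) (ρ : SpinorModule ε 𝕂 S)
    (C : ChargeConjugation ρ) {i : ι} (φ ψ : Π x : M, P.Spinors ρ x) {y : M}
    (hy : y ∈ P.baseSet i) :
    P.pairing ρ C y (φ y) (ψ y) = formL C (P.localRep ρ i φ y) (P.localRep ρ i ψ y) :=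
  (C.spin_invariant _ (P.mem_spinGroup _ i y ⟨P.mem_baseSet_at y, hy⟩) _ _).symm

theorem spinorDiffAt_iff (P : SpinStructure g ε ι) (ρ : SpinorModule ε 𝕂 S)
    (σ : Π x : M, P.Spinors ρ x) (x : M) :
    P.SpinorDiffAt ρ σ x ↔
      MDifferentiableAt (𝓡 n) 𝓘(ℝ, S) (P.localRep ρ (P.indexAt x) σ) x :=
  mdifferentiableAt_section (𝓡 n) σ

theorem exists_spinorDiffAt (P : SpinStructure g ε ι) (ρ : SpinorModule ε 𝕂 S) (x : M)
    (φ : P.Spinors ρ x) : ∃ σ : Π y : M, P.Spinors ρ y, P.SpinorDiffAt ρ σ x ∧ σ x = φ :=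
  ⟨FiberBundle.extend S φ, FiberBundle.mdifferentiableAt_extend (𝓡 n) S φ, by simp⟩

theorem eventually_mem_baseSet (P : SpinStructure g ε ι) (x : M) :
    ∀ᶠ y in 𝓝 x, y ∈ P.baseSet (P.indexAt x) :=
  (P.isOpen_baseSet _).mem_nhds (P.mem_baseSet_at x)

theorem localRep_clifford_eventuallyEq (P : SpinStructure g ε ι) (ρ : SpinorModule ε 𝕂 S)
    (X : Π y : M, TangentSpace (𝓡 n) y) (σ : Π x : M, P.Spinors ρ x) (x : M) :
    P.localRep ρ (P.indexAt x) (fun z ↦ P.clifford ρ z (X z) (σ z)) =ᶠ[𝓝 x]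
      fun y ↦ mulVecL ρ (P.coords (P.indexAt x) y (X y)) (P.localRep ρ (P.indexAt x) σ y) := by
  filter_upwards [P.eventually_mem_baseSet x] with y hy
  exact P.localRep_clifford ρ X σ hy

theorem mdifferentiableAt_coords (P : SpinStructure g ε ι) {cov : AffineConnection n M}
    (hcov : IsMetricAffine g cov) {i : ι} {x : M} (hx : x ∈ P.baseSet i)
    {X : Π y : M, TangentSpace (𝓡 n) y} (hX : FieldDiffAt X x) :
    MDifferentiableAt (𝓡 n) 𝓘(ℝ, Fin n → ℝ) (fun y ↦ P.coords i y (X y)) x := by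
  -- The direction `0` is a dummy: only the differentiability half is taken.
  have h := fun a ↦ (P.mvfderiv_coords hcov hx hX 0 a).1
  exact ⟨continuousWithinAt_pi.2 fun a ↦ (h a).1, differentiableWithinAt_pi.2 fun a ↦ (h a).2⟩

theorem SpinorDiffAt.clifford {P : SpinStructure g ε ι} {ρ : SpinorModule ε 𝕂 S}
    {cov : AffineConnection n M} (hcov : IsMetricAffine g cov)
    {X : Π y : M, TangentSpace (𝓡 n) y} {σ : Π x : M, P.Spinors ρ x} {x : M}
    (hX : FieldDiffAt X x) (hσ : P.SpinorDiffAt ρ σ x) :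
    P.SpinorDiffAt ρ (fun z ↦ P.clifford ρ z (X z) (σ z)) x := by
  rw [spinorDiffAt_iff] at hσ ⊢
  exact (hasMFDerivAt_bilinear (mulVecL ρ) (P.mdifferentiableAt_coords hcov (P.mem_baseSet_at x) hX)
    hσ).mdifferentiableAt.congr_of_eventuallyEq (P.localRep_clifford_eventuallyEq ρ X σ x)

/-- The connection coefficients `g(∇_v e_a, e_b)` in the preferred frame at `x`. -/
def connectionCoeff (P : SpinStructure g ε ι) (cov : AffineConnection n M) (x : M)
    (v : TangentSpace (𝓡 n) x) (a b : Fin n) : ℝ :=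
  g.inner x (cov (P.frame (P.indexAt x) a) x v) (P.frameAt x b)

/-- `g(e_a, e_b)` is constant near `x`, so its derivative vanishes. -/
theorem connectionCoeff_swap (P : SpinStructure g ε ι) {cov : AffineConnection n M}
    (hcov : IsMetricAffine g cov) (x : M) (v : TangentSpace (𝓡 n) x) (a b : Fin n) :
    P.connectionCoeff cov x v b a = -P.connectionCoeff cov x v a b := by
  have hx := P.mem_baseSet_at x
  have h := hcov x _ _ (P.fieldDiffAt_frame hx a) (P.fieldDiffAt_frame hx b) v
  have h1 : (fun y ↦ g.inner y (P.frame (P.indexAt x) a y) (P.frame (P.indexAt x) b y)) =ᶠ[𝓝 x]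
      fun _ ↦ if a = b then (((ε a : ℤˣ) : ℤ) : ℝ) else 0 := by
    filter_upwards [P.eventually_mem_baseSet x] with y hy
    exact P.orthonormal _ y hy a b
  rw [mvfderiv_congr_of_eventuallyEq h1, mvfderiv_const] at h
  have h2 : (0 : ℝ) = _ := h
  simp only [connectionCoeff, frameAt]
  rw [g.symm x (cov (P.frame (P.indexAt x) b) x v)]
  linarith

theorem spinLift_apply (P : SpinStructure g ε ι) (ρ : SpinorModule ε 𝕂 S)
    (cov : AffineConnection n M) (σ : Π x : M, P.Spinors ρ x) (x : M)
    (v : TangentSpace (𝓡 n) x) :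
    P.spinLift ρ cov σ x v = (mvfderiv (𝓡 n) (P.localRep ρ (P.indexAt x) σ) x v +
      (1 / 4 : ℝ) • ρ.cliffordTwo (P.connectionCoeff cov x v) (σ x : S) : S) := rfl

/-- The Leibniz rule for the spin lift and Clifford multiplication. -/
theorem spinLift_clifford (P : SpinStructure g ε ι) (ρ : SpinorModule ε 𝕂 S)
    {cov : AffineConnection n M} (hcov : IsMetricAffine g cov)
    {X : Π y : M, TangentSpace (𝓡 n) y} {σ : Π x : M, P.Spinors ρ x} {x : M}
    (hX : FieldDiffAt X x) (hσ : P.SpinorDiffAt ρ σ x) (v : TangentSpace (𝓡 n) x) :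
    P.spinLift ρ cov (fun z ↦ P.clifford ρ z (X z) (σ z)) x v =
      P.clifford ρ x (cov X x v) (σ x) + P.clifford ρ x (X x) (P.spinLift ρ cov σ x v) := by
  have hx := P.mem_baseSet_at x
  have hc := P.mdifferentiableAt_coords hcov hx hX
  -- The derivative of the components is that of a covariant derivative minus a rotation term. The
  -- product of `1/4` and `4` is left uncancelled so that this term has the shape of the bivector
  -- commutator.
  have hder : mvfderiv (𝓡 n) (fun y ↦ P.coords (P.indexAt x) y (X y)) x v =
      P.coords (P.indexAt x) x (cov X x v) - (1 / 4 : ℝ) • (fun b ↦ 4 * (((ε b : ℤ) : ℝ) *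
        ∑ d, P.coords (P.indexAt x) x (X x) d * P.connectionCoeff cov x v d b)) := by
    funext b
    rw [mvfderiv_pi hc, (P.mvfderiv_coords hcov hx hX v b).2]
    have e1 : g.inner x (X x) (cov (P.frame (P.indexAt x) b) x v) =
        -∑ d, P.coords (P.indexAt x) x (X x) d * P.connectionCoeff cov x v d b := by
      conv_lhs => rw [← P.sum_coords_smul_frame hx (X x)]
      simp only [map_sum, _root_.sum_apply, map_smul, _root_.smul_apply, smul_eq_mul,
        ← Finset.sum_neg_distrib]
      refine Finset.sum_congr rfl fun d _ ↦ ?_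
      rw [← mul_neg, ← P.connectionCoeff_swap hcov, g.symm]
      rfl
    rw [e1]
    simp only [Pi.sub_apply, Pi.smul_apply, smul_eq_mul]
    ring
  have hrep := (DFunLike.congr_fun (mvfderiv_congr_of_eventuallyEq
    (P.localRep_clifford_eventuallyEq ρ X σ x)) v).trans
      (mvfderiv_bilinear (mulVecL ρ) hc ((P.spinorDiffAt_iff ρ σ x).1 hσ) v)
  rw [hder, localRep_self] at hrep
  exact (congrArg₂ (· + ·) hrep rfl).trans <| ρ.mulVec_sub_commutator_apply _
    (P.connectionCoeff_swap hcov x v) _ _ (1 / 4) (σ x : S)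
      (mvfderiv (𝓡 n) (P.localRep ρ (P.indexAt x) σ) x v)

/-- The charge conjugation is parallel for the spin lift of a metric connection. -/
theorem mvfderiv_pairing (P : SpinStructure g ε ι) (ρ : SpinorModule ε 𝕂 S)
    (C : ChargeConjugation ρ) (cov : AffineConnection n M) {x : M}
    {φ ψ : Π x : M, P.Spinors ρ x} (hφ : P.SpinorDiffAt ρ φ x) (hψ : P.SpinorDiffAt ρ ψ x)
    (v : TangentSpace (𝓡 n) x) :
    mvfderiv (𝓡 n) (fun y ↦ P.pairing ρ C y (φ y) (ψ y)) x v =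
      P.pairing ρ C x (P.spinLift ρ cov φ x v) (ψ x) +
        P.pairing ρ C x (φ x) (P.spinLift ρ cov ψ x v) := by
  have h1 : (fun y ↦ P.pairing ρ C y (φ y) (ψ y)) =ᶠ[𝓝 x] fun y ↦
      formL C (P.localRep ρ (P.indexAt x) φ y) (P.localRep ρ (P.indexAt x) ψ y) := by
    filter_upwards [P.eventually_mem_baseSet x] with y hy
    exact P.pairing_eq_localRep ρ C φ ψ hy
  rw [mvfderiv_congr_of_eventuallyEq h1, mvfderiv_bilinear (formL C)
    ((P.spinorDiffAt_iff ρ φ x).1 hφ) ((P.spinorDiffAt_iff ρ ψ x).1 hψ), localRep_self,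
    localRep_self]
  -- The bivector terms cancel whatever the coefficients are.
  exact (C.form_add_cliffordTwo (P.connectionCoeff cov x v) (1 / 4) (φ x : S) (ψ x : S)
    (mvfderiv (𝓡 n) (P.localRep ρ (P.indexAt x) φ) x v)
    (mvfderiv (𝓡 n) (P.localRep ρ (P.indexAt x) ψ) x v)).symm

/-! ### Metric connections on spinors: `D^C`, admissibility, torsion and potential. -/

section Metric

variable {P : SpinStructure g ε ι} {ρ : SpinorModule ε 𝕂 S} {D : P.SpinorConnection ρ}
  {cov' cov : AffineConnection n M}

theorem IsMetricConnection.isChargeAssociated (hD : P.IsMetricConnection ρ D cov')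
    (C : ChargeConjugation ρ) : P.IsChargeAssociated ρ C D D := by
  intro x φ ψ hφ hψ v
  rw [hD.2 φ x hφ, hD.2 ψ x hψ]
  exact P.mvfderiv_pairing ρ C cov' hφ hψ v

/-- For a metric connection, `D^C = D`. -/
theorem IsMetricConnection.chargeAssociated_apply (hD : P.IsMetricConnection ρ D cov')
    {C : ChargeConjugation ρ} {DC : P.SpinorConnection ρ} (hDC : P.IsChargeAssociated ρ C D DC)
    {x : M} {ψ : Π x : M, P.Spinors ρ x} (hψ : P.SpinorDiffAt ρ ψ x) : DC ψ x = D ψ x := by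
  ext v
  have key : ∀ φ : S, C.form φ (DC ψ x v : S) = C.form φ (D ψ x v : S) := by
    intro φ
    obtain ⟨σ, hσ, rfl⟩ := P.exists_spinorDiffAt ρ x φ
    have h1 := hDC x σ ψ hσ hψ v
    rw [hD.isChargeAssociated C x σ ψ hσ hψ v] at h1
    exact (add_left_cancel h1).symm
  exact C.eq_of_form_eq key

/-- With `D^C = D`, the Leibniz rule for `cov'` cancels the term `γ(X) D ξ`; only the mismatch
between `cov'` and `cov` on `X` survives. -/
theorem IsMetricConnection.hatDGamma_eq (hD : P.IsMetricConnection ρ D cov')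
    {C : ChargeConjugation ρ} {DC : P.SpinorConnection ρ} (hDC : P.IsChargeAssociated ρ C D DC)
    {x : M} {Z X : Π y : M, TangentSpace (𝓡 n) y} {ξ : Π x : M, P.Spinors ρ x}
    (hX : FieldDiffAt X x) (hξ : P.SpinorDiffAt ρ ξ x) :
    P.hatDGamma ρ cov D DC Z X ξ x =
      P.clifford ρ x (cov'.difference cov x (X x) (Z x)) (ξ x) := by
  rw [hatDGamma, hD.chargeAssociated_apply hDC hξ, hD.2 _ x (SpinorDiffAt.clifford hD.1 hX hξ),
    hD.2 _ x hξ, P.spinLift_clifford ρ hD.1 hX hξ, difference_apply cov' cov hX, clifford_sub]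
  abel

theorem clifford_injective (P : SpinStructure g ε ι) (ρ : SpinorModule ε 𝕂 S) {x : M}
    {u v : TangentSpace (𝓡 n) x} (h : ∀ ψ, P.clifford ρ x u ψ = P.clifford ρ x v ψ) : u = v :=
  P.coords_injective (P.mem_baseSet_at x) (ρ.mulVec_injective (LinearMap.ext h))

theorem IsMetricConnection.isAdmissible_iff (hD : P.IsMetricConnection ρ D cov')
    (C : ChargeConjugation ρ) :
    P.IsAdmissible ρ C cov D ↔ ∀ (x : M) (u v w : TangentSpace (𝓡 n) x),
      differenceTensor g cov' cov x v u w = -differenceTensor g cov' cov x u v w := by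
  constructor
  · rintro ⟨DC, hDC, h⟩ x u v w
    obtain ⟨X, hX, rfl⟩ := exists_fieldDiffAt x u
    obtain ⟨Y, hY, rfl⟩ := exists_fieldDiffAt x v
    have h1 : cov'.difference cov x (X x) (Y x) = -cov'.difference cov x (Y x) (X x) := by
      apply P.clifford_injective ρ
      intro ψ
      obtain ⟨ξ, hξ, rfl⟩ := P.exists_spinorDiffAt ρ x ψ
      have h2 := h x Y X ξ hY hX hξ
      rw [hD.hatDGamma_eq hDC hX hξ, hD.hatDGamma_eq hDC hY hξ] at h2
      rw [h2, clifford_neg]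
    simp only [differenceTensor, h1, map_neg, _root_.neg_apply]
  · intro h
    -- `D` serves as its own `D^C`.
    refine ⟨D, hD.isChargeAssociated C, fun x Z X ξ hZ hX hξ ↦ ?_⟩
    have hC := hD.isChargeAssociated C
    rw [hD.hatDGamma_eq hC hX hξ, hD.hatDGamma_eq hC hZ hξ]
    have h1 : cov'.difference cov x (X x) (Z x) = -cov'.difference cov x (Z x) (X x) := by
      apply g.eq_of_inner
      intro w
      rw [map_neg, _root_.neg_apply]
      exact h x (X x) (Z x) w
    rw [h1, clifford_neg]

theorem IsMetricConnection.spinorTorsion_eq (hD : P.IsMetricConnection ρ D cov')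
    (hcov : cov.torsion = 0) {C : ChargeConjugation ρ} {DC : P.SpinorConnection ρ}
    (hDC : P.IsChargeAssociated ρ C D DC) {x : M} {X Y : Π y : M, TangentSpace (𝓡 n) y}
    {ξ : Π x : M, P.Spinors ρ x} (hX : FieldDiffAt X x) (hY : FieldDiffAt Y x)
    (hξ : P.SpinorDiffAt ρ ξ x) :
    P.spinorTorsion ρ cov D DC X Y ξ x =
      P.clifford ρ x (cov'.torsion x (X x) (Y x)) (ξ x) := by
  rw [spinorTorsion, hD.hatDGamma_eq hDC hX hξ, hD.hatDGamma_eq hDC hY hξ,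
    torsion_eq_difference_sub cov' hcov, clifford_sub]

/-- Both lifts contain the same derivative of the local representative. Their difference is that of
the connection forms, and the coefficients of the latter differ by `A` on the frame. -/
theorem IsMetricConnection.potential_eq (hD : P.IsMetricConnection ρ D cov') (x : M)
    (v : TangentSpace (𝓡 n) x) (ψ : P.Spinors ρ x) :
    P.potential ρ cov D x v ψ =
      P.cliffordForm ρ x (fun a b ↦ 1 / 4 * differenceTensor g cov' cov x v a b) ψ := by
  obtain ⟨σ, hσ, rfl⟩ := P.exists_spinorDiffAt ρ x ψ
  have h := congrArg (fun L ↦ L v) (IsCovariantDerivativeOn.difference_apply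
    D.isCovariantDerivativeOnUniv (P.spinLift ρ cov).isCovariantDerivativeOnUniv (x := x) trivial hσ)
  refine h.trans ?_
  change D σ x v - P.spinLift ρ cov σ x v = _
  rw [hD.2 σ x hσ, spinLift_apply, spinLift_apply]
  have hx := P.mem_baseSet_at x
  have hc : (fun a b ↦ 1 / 4 * differenceTensor g cov' cov x v (P.frameAt x a) (P.frameAt x b)) =
      fun a b ↦ 1 / 4 * (P.connectionCoeff cov' x v a b - P.connectionCoeff cov x v a b) := by
    funext a b
    rw [differenceTensor, frameAt, difference_apply cov' cov (P.fieldDiffAt_frame hx a), map_sub,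
      _root_.sub_apply]
    rfl
  rw [cliffordForm, hc, actFiber, SpinorModule.cliffordTwo_smul_sub]
  exact (add_sub_add_left_eq_sub _ _ _).trans (smul_sub (1 / 4 : ℝ) _ _).symm

end Metric

end SpinStructure

end SpinGeometry
end

/-! ### From a skew difference tensor to a smooth 3-form and back. -/

noncomputable section

namespace SpinGeometry

/-- The continuous alternating form given by a trilinear form that is skew-symmetric in its first
two and in its last two arguments. -/
def alternatingOfSkew {E : Type*} [AddCommGroup E] [Module ℝ E] [TopologicalSpace E]
    (B : E → E → E →ₗ[ℝ] ℝ) (h₁ : ∀ u v w, B v u w = -B u v w)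
    (h₂ : ∀ u v w, B u w v = -B u v w) (hB : Continuous fun m : Fin 3 → E ↦ B (m 0) (m 1) (m 2)) :
    E [⋀^Fin 3]→L[ℝ] ℝ :=
  -- Linearity is assumed in the last slot only; cyclic invariance carries it to the other two.
  have cyc : ∀ u v w, B u v w = B v w u := fun u v w ↦ by rw [h₂ v u w, h₁ u v w, neg_neg]
  { toFun := fun m ↦ B (m 0) (m 1) (m 2)
    map_update_add' := by
      intro inst m i u v
      obtain rfl : inst = instDecidableEqFin 3 := Subsingleton.elim _ _
      fin_cases i
      · simp only [Function.update_apply]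
        simp [cyc _ (m 1) (m 2)]
      · simp only [Function.update_apply]
        simp [cyc _ _ (m 2), cyc _ (m 2) (m 0)]
      · simp
    map_update_smul' := by
      intro inst m i c u
      obtain rfl : inst = instDecidableEqFin 3 := Subsingleton.elim _ _
      fin_cases i
      · simp only [Function.update_apply]
        simp [cyc _ (m 1) (m 2)]
      · simp only [Function.update_apply]
        simp [cyc _ _ (m 2), cyc _ (m 2) (m 0)]
      · simp
    cont := hB
    map_eq_zero_of_eq' := by
      intro m i j hm hij
      have z₁ : ∀ u w, B u u w = 0 := fun u w ↦ by linarith [h₁ u u w]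
      have z₂ : ∀ u w, B u w w = 0 := fun u w ↦ by linarith [h₂ u w w]
      have z₃ : ∀ u w, B u w u = 0 := fun u w ↦ by linarith [h₂ u w u, z₁ u w]
      change B (m 0) (m 1) (m 2) = 0
      have h : m 0 = m 1 ∨ m 1 = m 2 ∨ m 0 = m 2 := by
        fin_cases i <;> fin_cases j <;> first | exact absurd rfl hij | grind
      rcases h with h | h | h
      · rw [h, z₁]
      · rw [h, z₂]
      · rw [h, z₃] }

theorem continuous_bilinear_comp {E : Type*} [NormedAddCommGroup E] [NormedSpace ℝ E]
    (G : E →L[ℝ] E →L[ℝ] ℝ) (A : E →L[ℝ] E →L[ℝ] E) :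
    Continuous fun m : Fin 3 → E ↦ G (A (m 1) (m 0)) (m 2) := by
  have h : Continuous fun m : Fin 3 → E ↦ A (m 1) (m 0) :=
    (A.continuous.comp (continuous_apply 1)).clm_apply (continuous_apply 0)
  exact (G.continuous.comp h).clm_apply (continuous_apply 2)

section Tangent

variable {n : ℕ} {M : Type*} [TopologicalSpace M]
  [ChartedSpace (EuclideanSpace ℝ (Fin n)) M] [IsManifold (𝓡 n) ∞ M]

theorem continuous_differenceTensor (g : PseudoRiemannianMetric n M)
    (cov' cov : AffineConnection n M) (x : M) :
    Continuous fun m : Fin 3 → TangentSpace (𝓡 n) x ↦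
      differenceTensor g cov' cov x (m 0) (m 1) (m 2) := by
  let A : EuclideanSpace ℝ (Fin n) →L[ℝ] EuclideanSpace ℝ (Fin n) →L[ℝ]
    EuclideanSpace ℝ (Fin n) := cov'.difference cov x
  exact continuous_bilinear_comp (E := EuclideanSpace ℝ (Fin n)) (g.inner x) A

theorem fieldSmoothOn_cov (cov : AffineConnection n M)
    [hcov : CovariantDerivative.ContMDiffCovariantDerivative cov ∞]
    {X Y : Π y : M, TangentSpace (𝓡 n) y} (hX : FieldSmoothOn X Set.univ)
    (hY : FieldSmoothOn Y Set.univ) : FieldSmoothOn (fun x ↦ cov Y x (X x)) Set.univ := by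
  have h := hcov.contMDiff.contMDiff (σ := Y) hY
  exact ContMDiffOn.clm_bundle_apply (F₁ := EuclideanSpace ℝ (Fin n))
    (F₂ := EuclideanSpace ℝ (Fin n)) h hX

theorem fieldDiffAt_of_smooth {X : Π y : M, TangentSpace (𝓡 n) y}
    (hX : FieldSmoothOn X Set.univ) (x : M) : FieldDiffAt X x :=
  ((contMDiffOn_univ.1 hX) x).mdifferentiableAt (by simp)

/-- A multiple of the difference tensor of two smooth metric connections as a 3-form, provided
that it is totally skew-symmetric. -/
def differenceForm (g : PseudoRiemannianMetric n M) (cov' cov : AffineConnection n M)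
    [CovariantDerivative.ContMDiffCovariantDerivative cov' ∞]
    [CovariantDerivative.ContMDiffCovariantDerivative cov ∞] (r : ℝ)
    (h₁ : ∀ (x : M) (u v w : TangentSpace (𝓡 n) x),
      differenceTensor g cov' cov x v u w = -differenceTensor g cov' cov x u v w)
    (h₂ : ∀ (x : M) (u v w : TangentSpace (𝓡 n) x),
      differenceTensor g cov' cov x u w v = -differenceTensor g cov' cov x u v w) :
    ThreeForm n M where
  toFun x := alternatingOfSkew
    (fun u v ↦ r • (g.inner x (cov'.difference cov x v u)).toLinearMap)
    (fun u v w ↦ (congrArg (r * ·) (h₁ x u v w)).trans (mul_neg _ _))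
    (fun u v w ↦ (congrArg (r * ·) (h₂ x u v w)).trans (mul_neg _ _))
    (continuous_const.mul (continuous_differenceTensor g cov' cov x))
  smooth X Y Z hX hY hZ := by
    -- On smooth fields `A(X,Y,Z) = g(∇'_X Y, Z) - g(∇_X Y, Z)`, and each term is smooth because the
    -- connections are.
    have h := (g.contMDiff_inner (fieldSmoothOn_cov cov' hX hY) hZ).sub
      (g.contMDiff_inner (fieldSmoothOn_cov cov hX hY) hZ)
    have hr : ContMDiff (𝓡 n) 𝓘(ℝ, ℝ) ∞ (fun _ : M ↦ r) := contMDiff_const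
    refine (hr.mul h).congr fun x ↦ ?_
    change r * g.inner x (cov'.difference cov x (Y x) (X x)) (Z x) = _
    rw [difference_apply cov' cov (fieldDiffAt_of_smooth hY x), map_sub, _root_.sub_apply]
    rfl

end Tangent

namespace ThreeForm

variable {n : ℕ} {M : Type*} [TopologicalSpace M]
  [ChartedSpace (EuclideanSpace ℝ (Fin n)) M] [IsManifold (𝓡 n) ∞ M]

theorem swap_left (F : ThreeForm n M) (x : M) (u v w : TangentSpace (𝓡 n) x) :
    F.toFun x ![v, u, w] = -F.toFun x ![u, v, w] := by
  have h := (F.toFun x).toAlternatingMap.map_swap ![u, v, w] (i := 0) (j := 1) (by decide)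
  have e : (![u, v, w] ∘ Equiv.swap (0 : Fin 3) 1) = ![v, u, w] := by
    funext i; fin_cases i <;> rfl
  rw [e] at h
  exact h

theorem swap_right (F : ThreeForm n M) (x : M) (u v w : TangentSpace (𝓡 n) x) :
    F.toFun x ![u, w, v] = -F.toFun x ![u, v, w] := by
  have h := (F.toFun x).toAlternatingMap.map_swap ![u, v, w] (i := 1) (j := 2) (by decide)
  have e : (![u, v, w] ∘ Equiv.swap (1 : Fin 3) 2) = ![u, w, v] := by
    funext i; fin_cases i <;> rfl
  rw [e] at h
  exact h

/-- The interior product with a tangent vector, as a bilinear map. -/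
theorem exists_linearMap (F : ThreeForm n M) (x : M) (u : TangentSpace (𝓡 n) x) :
    ∃ β : TangentSpace (𝓡 n) x →ₗ[ℝ] TangentSpace (𝓡 n) x →ₗ[ℝ] ℝ,
      ∀ a b, β a b = F.toFun x ![u, a, b] := by
  have e1 : ∀ a b : TangentSpace (𝓡 n) x, ![u, a, b] = Function.update ![u, 0, b] 1 a := by
    intro a b; funext i; fin_cases i <;> rfl
  have e2 : ∀ a b : TangentSpace (𝓡 n) x, ![u, a, b] = Function.update ![u, a, 0] 2 b := by
    intro a b; funext i; fin_cases i <;> rfl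
  refine ⟨LinearMap.mk₂ ℝ (fun a b ↦ F.toFun x ![u, a, b]) (fun a a' b ↦ ?_) (fun c a b ↦ ?_)
    (fun a b b' ↦ ?_) (fun c a b ↦ ?_), fun _ _ ↦ rfl⟩
  · rw [e1 (a + a') b, e1 a b, e1 a' b]
    exact (F.toFun x).map_update_add _ _ _ _
  · rw [e1 (c • a) b, e1 a b]
    exact (F.toFun x).map_update_smul _ _ _ _
  · rw [e2 a (b + b'), e2 a b, e2 a b']
    exact (F.toFun x).map_update_add _ _ _ _
  · rw [e2 a (c • b), e2 a b]
    exact (F.toFun x).map_update_smul _ _ _ _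

end ThreeForm

namespace SpinStructure

variable {n : ℕ} {M : Type*} [TopologicalSpace M]
  [ChartedSpace (EuclideanSpace ℝ (Fin n)) M] [IsManifold (𝓡 n) ∞ M]
  {g : PseudoRiemannianMetric n M} {ε : Fin n → ℤˣ} {ι : Type*}
  {𝕂 : Type*} [RCLike 𝕂] {S : Type*}
  [NormedAddCommGroup S] [NormedSpace ℝ S] [NormedSpace 𝕂 S] [IsScalarTower ℝ 𝕂 S]
  [FiniteDimensional ℝ S]

/-- A linear map out of the tangent space is determined by its values on the frame. -/
theorem linearMap_ext_frame (P : SpinStructure g ε ι) {x : M} {W : Type*} [AddCommGroup W]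
    [Module ℝ W] {f h : TangentSpace (𝓡 n) x →ₗ[ℝ] W}
    (H : ∀ a, f (P.frameAt x a) = h (P.frameAt x a)) : f = h :=
  LinearMap.ext_on_range (P.span_frame (P.mem_baseSet_at x)) H

/-- A skew bilinear form is determined by its Clifford action. -/
theorem eq_of_cliffordForm_eq (P : SpinStructure g ε ι) (ρ : SpinorModule ε 𝕂 S) {x : M}
    {β β' : TangentSpace (𝓡 n) x →ₗ[ℝ] TangentSpace (𝓡 n) x →ₗ[ℝ] ℝ}
    (hβ : ∀ u v, β v u = -β u v) (hβ' : ∀ u v, β' v u = -β' u v)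
    (h : ∀ ψ, P.cliffordForm ρ x (fun u v ↦ β u v) ψ = P.cliffordForm ρ x (fun u v ↦ β' u v) ψ) :
    β = β' := by
  have hc := ρ.eq_of_cliffordTwo_eq (fun _ _ ↦ hβ _ _) (fun _ _ ↦ hβ' _ _) (LinearMap.ext h)
  exact P.linearMap_ext_frame fun a ↦ P.linearMap_ext_frame fun b ↦ congrFun (congrFun hc a) b

variable {P : SpinStructure g ε ι} {ρ : SpinorModule ε 𝕂 S} {D : P.SpinorConnection ρ}
  {cov' cov : AffineConnection n M}

/-- For fixed `u`, both `A(u,·,·)/4` and the contraction of `F` with `u` are skew forms with the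
same Clifford action, hence equal. -/
theorem IsMetricConnection.differenceTensor_eq_of_potential_eq
    (hD : P.IsMetricConnection ρ D cov') (hcov : IsMetricAffine g cov) (F : ThreeForm n M)
    (hF : ∀ (x : M) (v : TangentSpace (𝓡 n) x) (ψ : P.Spinors ρ x),
      P.potential ρ cov D x v ψ = P.cliffordForm ρ x (fun a b ↦ F.toFun x ![v, a, b]) ψ)
    (x : M) (u v w : TangentSpace (𝓡 n) x) :
    1 / 4 * differenceTensor g cov' cov x u v w = F.toFun x ![u, v, w] := by
  obtain ⟨β, hβ⟩ : ∃ β : TangentSpace (𝓡 n) x →ₗ[ℝ] TangentSpace (𝓡 n) x →ₗ[ℝ] ℝ,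
      ∀ a b, β a b = 1 / 4 * differenceTensor g cov' cov x u a b :=
    ⟨LinearMap.mk₂ ℝ (fun a b ↦ 1 / 4 * differenceTensor g cov' cov x u a b)
      (fun _ _ _ ↦ by simp [differenceTensor, mul_add])
      (fun _ _ _ ↦ by simp [differenceTensor, mul_left_comm])
      (fun _ _ _ ↦ by simp [differenceTensor, mul_add])
      (fun _ _ _ ↦ by simp [differenceTensor, mul_left_comm]), fun _ _ ↦ rfl⟩
  obtain ⟨β', hβ'⟩ := F.exists_linearMap x u
  have h : β = β' := by
    refine P.eq_of_cliffordForm_eq ρ (fun a b ↦ ?_) (fun a b ↦ ?_) (fun ψ ↦ ?_)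
    · rw [hβ, hβ, differenceTensor_swap_right hD.1 hcov x u a b, mul_neg]
    · rw [hβ', hβ', F.swap_right]
    · simp only [hβ, hβ']
      exact (hD.potential_eq x u ψ).symm.trans (hF x u ψ)
  rw [← hβ, ← hβ', h]

end SpinStructure

end SpinGeometry
end

/-! ### Assembly of the corollary. -/

open SpinGeometry in
theorem corollary4p7 {n : ℕ} {M : Type*} [TopologicalSpace M] [T2Space M] [SigmaCompactSpace M]
    [ChartedSpace (EuclideanSpace ℝ (Fin n)) M] [IsManifold (𝓡 n) ∞ M]
    (g : PseudoRiemannianMetric n M) {ε : Fin n → ℤˣ} {ι : Type*} (P : SpinStructure g ε ι)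
    {𝕂 : Type*} [RCLike 𝕂] {S : Type*} [NormedAddCommGroup S] [NormedSpace ℝ S]
    [NormedSpace 𝕂 S] [IsScalarTower ℝ 𝕂 S] [FiniteDimensional ℝ S]
    (ρ : SpinorModule ε 𝕂 S) (C : ChargeConjugation ρ)
    (nabla : AffineConnection n M)
    [CovariantDerivative.ContMDiffCovariantDerivative nabla ∞]
    (hnabla : IsLeviCivita g nabla)
    (nablaD : AffineConnection n M)
    [CovariantDerivative.ContMDiffCovariantDerivative nablaD ∞]
    (D : P.SpinorConnection ρ) (hD : P.IsMetricConnection ρ D nablaD) :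
    (∀ (x : M) (v : TangentSpace (𝓡 n) x) (ψ : P.Spinors ρ x),
      P.potential ρ nabla D x v ψ =
        P.cliffordForm ρ x (fun a b ↦ 1 / 4 * differenceTensor g nablaD nabla x v a b) ψ) ∧
    (∀ DC : P.SpinorConnection ρ, P.IsChargeAssociated ρ C D DC →
      ∀ (x : M) (X Y : Π y : M, TangentSpace (𝓡 n) y) (ξ : Π y : M, P.Spinors ρ y),
        FieldDiffAt X x → FieldDiffAt Y x → P.SpinorDiffAt ρ ξ x →
          P.spinorTorsion ρ nabla D DC X Y ξ x =
            P.clifford ρ x (nablaD.torsion x (X x) (Y x)) (ξ x)) ∧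
    (P.IsAdmissible ρ C nabla D ↔
      ∃ F : ThreeForm n M, ∀ (x : M) (v : TangentSpace (𝓡 n) x) (ψ : P.Spinors ρ x),
        P.potential ρ nabla D x v ψ =
          P.cliffordForm ρ x (fun a b ↦ F.toFun x ![v, a, b]) ψ) ∧
    (P.IsAdmissible ρ C nabla D ↔ IsTotallySkew (loweredTorsion g nablaD)) ∧
    (P.IsAdmissible ρ C nabla D → ∀ (x : M) (u v w : TangentSpace (𝓡 n) x),
      loweredTorsion g nablaD x u v w =
        differenceTensor g nablaD nabla x u v w - differenceTensor g nablaD nabla x v u w ∧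
      loweredTorsion g nablaD x u v w = 2 * differenceTensor g nablaD nabla x u v w) := by
  have hadm := hD.isAdmissible_iff (cov := nabla) C
  refine ⟨hD.potential_eq, fun DC hDC x X Y ξ hX hY hξ ↦
    hD.spinorTorsion_eq hnabla.2 hDC hX hY hξ, ⟨fun h ↦ ?_, ?_⟩,
    hadm.trans (isTotallySkew_loweredTorsion_iff hD.1 hnabla).symm, fun h x u v w ↦ ?_⟩
  -- The witness is `A/4`: admissibility gives skewness in the first pair of arguments, metricity in
  -- the last pair.
  · exact ⟨differenceForm g nablaD nabla (1 / 4) (hadm.1 h)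
      (differenceTensor_swap_right hD.1 hnabla.1), hD.potential_eq⟩
  · rintro ⟨F, hF⟩
    rw [hadm]
    intro x u v w
    have hA := hD.differenceTensor_eq_of_potential_eq hnabla.1 F hF x
    linarith [hA u v w, hA v u w, F.swap_left x u v w]
  · have hT := loweredTorsion_eq g nablaD hnabla.2 x u v w
    exact ⟨hT, by rw [hT, hadm.1 h x u v w]; ring⟩
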